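/- Let $(X,\mathcal X)$ and $(Y,\mathcal Y)$ be measurable spaces with $X\neq\emptyset$, and let $\mathcal P(X)$, $\mathcal P(Y)$ denote the sets of all probability measures on them. For probability measures $W,Q$ on a common measurable space, and any $\sigma$-finite reference measure $\nu$ with $W,Q\ll\nu$, densities $w=\frac{dW}{d\nu}$, $q=\frac{dQ}{d\nu}$, the order $\alpha\in(0,\infty]$ Rényi divergence is $$D_\alpha(W\|Q)=\begin{cases}\frac1{\alpha-1}\ln\int w^{\alpha}q^{1-\alpha}\,d\nu,&\alpha\in(0,\infty)\setminus\{1\},\\ \int w\,(\ln w-\ln q)\,d\nu,&\alpha=1,\\ \ln\operatorname{ess\,sup}_\nu \frac{w}{q},&\alpha=\infty,\end{cases}$$ with values in $[0,\infty]$ and the conventions $0/0=0$, $x/0=\infty$ for $x>0$, $0\ln 0=0$, and with zero contribution from points where $w=q=0$. Let $\mathcal W(\cdot|\cdot)$ be a transition probability (Markov kernel) from $(X,\mathcal X)$ to $(Y,\mathcal Y)$. For $P\in\mathcal P(X)$ let $P\circledast\mathcal W$ be the probability measure on $\mathcal X\otimes\mathcal Y$ with $(P\circledast\mathcal W)(A\times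 B)=\int_A\mathcal W(x|B)\,P(dx)$ for all $A\in\mathcal X$, $B\in\mathcal Y$, and define the order $\alpha$ Rényi information and capacity by $$I_\alpha(P;\mathcal W)=\inf_{Q\in\mathcal P(Y)}D_\alpha(P\circledast\mathcal W\,\|\,P\otimes Q),\qquad C_{\alpha,\mathcal W}=\sup_{P\in\mathcal P(X)}I_\alpha(P;\mathcal W).$$ **Theorem.** Let $\alpha\in(0,\infty]$, and suppose that $\mathcal X$ is countably separated, i.e. that some countable subfamily of $\mathcal X$ separates the points of $X$. Put $\mathscr W=\{\mathcal W(x|\cdot):x\in X\}\subset\mathcal P(Y)$. Then $$C_{\alpha,\mathcal W}=\sup_{P\in\mathcal P(X)}\inf_{Q\in\mathcal P(Y)}D_\alpha(P\circledast\mathcal W\|P\otimes Q)=\inf_{Q\in\mathcal P(Y)}\sup_{P\in\mathcal P(X)}D_\alpha(P\circledast\mathcal W\|P\otimes Q)=\inf_{Q\in\mathcal P(Y)}\sup_{W\in\mathscr W}D_\alpha(W\|Q).$$ If $C_{\alpha,\mathcal W}<\infty$, then there is a unique $q\in\mathcal P(Y)$ with $$C_{\alpha,\mathcal W}=\sup_{P\in\mathcal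 P(X)}D_\alpha(P\circledast\mathcal W\|P\otimes q),$$ and this $q$ also satisfies $C_{\alpha,\mathcal W}=\sup_{W\in\mathscr W}D_\alpha(W\|q)$. Moreover, $q$ is the unique order $\alpha$ Rényi center of $\mathscr W$, i.e. the only $q'\in\mathcal P(Y)$ with $\sup_{W\in\mathscr W}D_\alpha(W\|q')=\inf_{Q\in\mathcal P(Y)}\sup_{W\in\mathscr W}D_\alpha(W\|Q)$. -/

import Mathlib

open MeasureTheory ProbabilityTheory
open scoped ENNReal

namespace Renyi

noncomputable section

open scoped Classical in
/-- The order `α ∈ [0, ∞]` Rényi divergence between two (non-zero, finite) measures `W` and `Q`,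
with values in `[-∞, ∞]`. Densities are taken with respect to the reference measure `W + Q`.
In `[0, ∞]` we have `0 ^ (1 - α) = ∞` for `α > 1`, `0 * ∞ = 0`, `0 / 0 = 0` and `x / 0 = ∞` for
`x > 0`, which are the usual conventions for points where the density of `Q` vanishes.
For `α = 1` this is the Kullback-Leibler divergence: the negative part of `log (dW / dQ)` is always
`W`-integrable, so the integral is `∞` whenever `W ≪ Q` and the integrand is not integrable. -/
def divergence {Y : Type*} [MeasurableSpace Y] (α : ℝ≥0∞) (W Q : Measure Y) : EReal :=
  if α = 0 then
    -ENNReal.log (Q {y | 0 < W.rnDeriv (W + Q) y})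
  else if α = 1 then
    if W ≪ Q ∧ Integrable (llr W Q) W then ((∫ y, llr W Q y ∂W : ℝ) : EReal) else ⊤
  else if α = ∞ then
    ENNReal.log (essSup (fun y => W.rnDeriv (W + Q) y / Q.rnDeriv (W + Q) y) (W + Q))
  else
    (((α.toReal - 1)⁻¹ : ℝ) : EReal) *
      ENNReal.log (∫⁻ y, W.rnDeriv (W + Q) y ^ α.toReal *
        Q.rnDeriv (W + Q) y ^ (1 - α.toReal) ∂(W + Q))

/-- The order `α` Rényi radius of a set `S` of probability measures relative to `Q`. -/
def relativeRadius {Y : Type*} [MeasurableSpace Y] (α : ℝ≥0∞)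
    (S : Set (ProbabilityMeasure Y)) (Q : ProbabilityMeasure Y) : EReal :=
  ⨆ W ∈ S, divergence α (W : Measure Y) (Q : Measure Y)

/-- The order `α` Rényi radius of a set `S` of probability measures. -/
def radius {Y : Type*} [MeasurableSpace Y] (α : ℝ≥0∞) (S : Set (ProbabilityMeasure Y)) : EReal :=
  ⨅ Q : ProbabilityMeasure Y, relativeRadius α S Q

/-- `Q` is an order `α` Rényi center of the set `S` of probability measures. -/
def IsCenter {Y : Type*} [MeasurableSpace Y] (α : ℝ≥0∞)
    (S : Set (ProbabilityMeasure Y)) (Q : ProbabilityMeasure Y) : Prop :=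
  relativeRadius α S Q = radius α S

/-- The divergence between the joint law `P ⊛ κ` on `X × Y` of the input and the output
of the transition probability `κ` with prior `P`, and the product measure `P ⊗ Q`. -/
def jointDivergence {X Y : Type*} [MeasurableSpace X] [MeasurableSpace Y] (α : ℝ≥0∞)
    (P : ProbabilityMeasure X) (κ : Kernel X Y) (Q : ProbabilityMeasure Y) : EReal :=
  divergence α ((P : Measure X).compProd κ) ((P : Measure X).prod (Q : Measure Y))

/-- The order `α` Rényi information for the prior `P` on the transition probability `κ`. -/
def information {X Y : Type*} [MeasurableSpace X] [MeasurableSpace Y] (α : ℝ≥0∞)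
    (P : ProbabilityMeasure X) (κ : Kernel X Y) : EReal :=
  ⨅ Q : ProbabilityMeasure Y, jointDivergence α P κ Q

/-- The order `α` Rényi capacity of the transition probability `κ`; the supremum is over all
probability measures on the input space. -/
def capacity {X Y : Type*} [MeasurableSpace X] [MeasurableSpace Y] (α : ℝ≥0∞)
    (κ : Kernel X Y) : EReal :=
  ⨆ P : ProbabilityMeasure X, information α P κ

/-- The set `{κ(x|·) : x ∈ X}` of the output measures of the transition probability `κ`. -/
def outputs {X Y : Type*} [MeasurableSpace X] [MeasurableSpace Y]
    (κ : Kernel X Y) [IsMarkovKernel κ] : Set (ProbabilityMeasure Y) :=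
  Set.range fun x => (⟨κ x, inferInstance⟩ : ProbabilityMeasure Y)

end

end Renyi

namespace Renyi

open Filter Topology

/-! For finite `α`, an increasing function of the Rényi divergence is an f-divergence `J`: the
Kullback-Leibler divergence itself if `α = 1`, and `(exp ((α - 1) D) - 1) / (α - 1)` otherwise. If
`A t * r + B t` is the tangent at `t` to the generator of `J`, then `J(W, Q)` is the supremum of `∫
A(t) dW + ∫ B(t) dQ` over measurable `t` with values in a compact part of `(0, ∞)`. This form needs
no densities and is lower semicontinuous in `Q` for total variation. It also averages: the joint law
has divergence at most the `P`-average of `J(κ x, Q)`, with equality for finitely supported `P`.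
Averaging in one direction and point masses in the other show that, for fixed `Q`, the supremum over
priors is the supremum over `x`.

It remains to find a unique `q` whose divergence from every `κ x` is at most the capacity. For a
finitely supported `P` the output law minimising the average of `J(κ x, ·)` is explicit: a mixture
if `α = 1`, a normalised power mean of the densities otherwise. It satisfies a Pythagorean
inequality: the average at `Q` is at least the average at the center plus `b * J(center, Q)`, where
`b > 0` is uniform over priors with bounded average.

Take finite priors `P n` whose minimal averages approach their supremum `C`, and mix a late one with
a small weight of another prior `P'`. Since the mixture cannot beat `C`, its center stays close to
that of `P n`, and the `P'`-average at this center is at most about `C`. With `P' = P m` this makes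
the centers Cauchy in total variation, because small `J` forces small total variation. With `P'` the
point mass at `x` and lower semicontinuity, the limit `q` satisfies `J(κ x, q) ≤ C`. Any other law
with this property is close to all late centers by the Pythagorean inequality, so it equals `q`. The
bound at `q` also shows that finite priors already exhaust the capacity.

For `α = ∞`, divergence at most `d` means `W ≤ exp d • Q`. The least measure `μ` above all `κ x`
then gives everything: the capacity is the logarithm of its mass, and the center is `μ` normalised.
-/

theorem ofReal_integral_le_lintegral_ofReal {Y : Type*} [MeasurableSpace Y] {ν : Measure Y}
    {f : Y → ℝ} (hf : Integrable f ν) :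
    ENNReal.ofReal (∫ y, f y ∂ν) ≤ ∫⁻ y, ENNReal.ofReal (f y) ∂ν := by
  refine (ENNReal.ofReal_le_ofReal (integral_mono hf hf.pos_part fun x => le_max_left _ 0)).trans ?_
  rw [ofReal_integral_eq_lintegral_ofReal hf.pos_part (ae_of_all _ fun x => le_max_right _ _)]
  simp_rw [ENNReal.ofReal_max, ENNReal.ofReal_zero, max_zero]
  exact le_rfl

/-! ### Variational f-divergences and their behaviour under joint laws -/

/-- Measurable functions bounded away from zero and infinity. -/
def TestFunction (Y : Type*) [MeasurableSpace Y] : Type _ :=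
  {t : Y → ℝ // Measurable t ∧ ∃ ε : ℝ, 0 < ε ∧ ∀ y, t y ∈ Set.Icc ε ε⁻¹}

namespace TestFunction

variable {Y : Type*} [MeasurableSpace Y]

instance : CoeFun (TestFunction Y) fun _ => Y → ℝ := ⟨Subtype.val⟩

theorem measurable (t : TestFunction Y) : Measurable t := t.2.1

theorem pos (t : TestFunction Y) (y : Y) : 0 < t y := by
  obtain ⟨ε, hε, h⟩ := t.2.2
  exact hε.trans_le (h y).1

/-- The constant test function `1`. -/
def one (Y : Type*) [MeasurableSpace Y] : TestFunction Y :=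
  ⟨fun _ => 1, measurable_const, 1, one_pos, by simp⟩

open scoped Classical in
/-- The test function equal to `s` on `B` and to `1` elsewhere. -/
noncomputable def ofSet (B : Set Y) (hB : MeasurableSet B) (s : ℝ) (hs : 0 < s) :
    TestFunction Y :=
  ⟨B.piecewise (fun _ => s) fun _ => 1, measurable_const.piecewise hB measurable_const,
    min s (min s⁻¹ 1), by positivity, fun y => by
      by_cases hy : y ∈ B
      · simp only [hy, Set.piecewise_eq_of_mem, Set.mem_Icc, min_le_iff, le_refl, true_or, true_and]
        rw [le_inv_comm₀ hs (by positivity)]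
        simp
      · simp only [hy, not_false_eq_true, Set.piecewise_eq_of_notMem, Set.mem_Icc, min_le_iff,
          le_refl, or_true, true_and]
        rw [le_inv_comm₀ one_pos (by positivity)]
        simp⟩

theorem exists_forall_mem_Icc (t : TestFunction Y) {A : ℝ → ℝ}
    (hA : MonotoneOn A (Set.Ioi 0) ∨ AntitoneOn A (Set.Ioi 0)) :
    ∃ M, ∀ y, |A (t y)| ≤ M := by
  obtain ⟨ε, hε, h⟩ := t.2.2
  refine ⟨max |A ε| |A ε⁻¹|, fun y => ?_⟩
  have h1 := (h y).1
  have h2 := (h y).2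
  have h3 := t.pos y
  have h4 : 0 < ε⁻¹ := by positivity
  rcases hA with hA | hA
  · have h5 := hA (Set.mem_Ioi.2 hε) h3 h1
    have h6 := hA h3 (Set.mem_Ioi.2 h4) h2
    exact abs_le_max_abs_abs h5 h6
  · have h5 := hA (Set.mem_Ioi.2 hε) h3 h1
    have h6 := hA h3 (Set.mem_Ioi.2 h4) h2
    rw [max_comm]
    exact abs_le_max_abs_abs h6 h5

/-- Finiteness is what provides a common bound `ε`: an infinite family of test functions need not be
uniformly bounded away from zero and infinity. -/
theorem exists_of_finset {X : Type*} [MeasurableSpace X] [MeasurableSingletonClass X]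
    (s : Finset X) (τ : X → TestFunction Y) :
    ∃ T : TestFunction (X × Y), ∀ x ∈ s, ∀ y, T (x, y) = τ x y := by
  classical
  induction s using Finset.cons_induction with
  | empty => exact ⟨one _, by simp⟩
  | cons a s ha ih =>
    obtain ⟨T, hT⟩ := ih
    obtain ⟨ε, hε, h⟩ := T.2.2
    obtain ⟨δ, hδ, h'⟩ := (τ a).2.2
    have hS : MeasurableSet {p : X × Y | p.1 = a} := measurable_fst (measurableSet_singleton a)
    have hm : 0 < min ε δ := lt_min hε hδ
    refine ⟨⟨Set.piecewise {p : X × Y | p.1 = a} (fun p => τ a p.2) T,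
      ((τ a).measurable.comp measurable_snd).piecewise hS T.measurable, min ε δ, hm,
      fun p => ?_⟩, fun x hx y => ?_⟩
    · have h1 : ε⁻¹ ≤ (min ε δ)⁻¹ := inv_anti₀ hm (min_le_left _ _)
      have h2 : δ⁻¹ ≤ (min ε δ)⁻¹ := inv_anti₀ hm (min_le_right _ _)
      by_cases hp : p.1 = a
      · rw [Set.piecewise_eq_of_mem _ _ _ (show p ∈ {p : X × Y | p.1 = a} from hp)]
        exact ⟨(min_le_right _ _).trans (h' _).1, (h' _).2.trans h2⟩
      · rw [Set.piecewise_eq_of_notMem _ _ _ (show p ∉ {p : X × Y | p.1 = a} from hp)]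
        exact ⟨(min_le_left _ _).trans (h _).1, (h _).2.trans h1⟩
    · by_cases hp : x = a
      · subst hp
        exact Set.piecewise_eq_of_mem {p : X × Y | p.1 = x} (fun p => τ x p.2) T
          (show (x, y) ∈ {p : X × Y | p.1 = x} from rfl)
      · refine (Set.piecewise_eq_of_notMem {p : X × Y | p.1 = a} (fun p => τ a p.2) T
          (show (x, y) ∉ {p : X × Y | p.1 = a} from hp)).trans (hT x ?_ y)
        simpa [hp] using hx

/-- The section of a test function on a product space. -/
def sectionAt {X : Type*} [MeasurableSpace X] (T : TestFunction (X × Y)) (x : X) :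
    TestFunction Y :=
  ⟨fun y => T (x, y), T.measurable.comp measurable_prodMk_left,
    T.2.2.imp fun _ h => ⟨h.1, fun y => h.2 (x, y)⟩⟩

end TestFunction

/-- The coefficient functions of the tangent lines of the generator of an `f`-divergence. -/
structure TangentPair (A B : ℝ → ℝ) (c : ℝ) : Prop where
  measurable_left : Measurable A
  measurable_right : Measurable B
  monotone : MonotoneOn A (Set.Ioi 0)
  antitone : AntitoneOn B (Set.Ioi 0)
  left_one : A 1 = 0
  right_one : B 1 = 0
  pos : 0 < c
  hasDerivAt_left : HasDerivAt A c 1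
  hasDerivAt_right : HasDerivAt B (-c) 1

/-- The linear functional of a pair of measures given by a test function. -/
noncomputable def tangentValue {Y : Type*} [MeasurableSpace Y] (A B : ℝ → ℝ) (t : TestFunction Y)
    (W Q : Measure Y) : ℝ :=
  ∫ y, A (t y) ∂W + ∫ y, B (t y) ∂Q

/-- The variational form of an `f`-divergence. -/
noncomputable def dualDivergence {Y : Type*} [MeasurableSpace Y] (A B : ℝ → ℝ)
    (W Q : Measure Y) : ℝ≥0∞ :=
  ⨆ t : TestFunction Y, ENNReal.ofReal (tangentValue A B t W Q)

theorem le_dualDivergence {Y : Type*} [MeasurableSpace Y] (A B : ℝ → ℝ) (t : TestFunction Y)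
    (W Q : Measure Y) : ENNReal.ofReal (tangentValue A B t W Q) ≤ dualDivergence A B W Q :=
  le_iSup (fun t : TestFunction Y => ENNReal.ofReal (tangentValue A B t W Q)) t

namespace TangentPair

variable {X Y : Type*} [MeasurableSpace X] [MeasurableSpace Y] {A B : ℝ → ℝ} {c : ℝ}

theorem integrable_left (h : TangentPair A B c) (t : TestFunction Y) (W : Measure Y)
    [IsFiniteMeasure W] : Integrable (fun y => A (t y)) W := by
  obtain ⟨M, hM⟩ := t.exists_forall_mem_Icc (.inl h.monotone)
  exact Integrable.of_bound (h.measurable_left.comp t.measurable).aestronglyMeasurable M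
    (ae_of_all _ hM)

theorem integrable_right (h : TangentPair A B c) (t : TestFunction Y) (W : Measure Y)
    [IsFiniteMeasure W] : Integrable (fun y => B (t y)) W := by
  obtain ⟨M, hM⟩ := t.exists_forall_mem_Icc (.inr h.antitone)
  exact Integrable.of_bound (h.measurable_right.comp t.measurable).aestronglyMeasurable M
    (ae_of_all _ hM)

theorem tangentValue_one (h : TangentPair A B c) (W Q : Measure Y) :
    tangentValue A B (TestFunction.one Y) W Q = 0 := by
  simp [tangentValue, TestFunction.one, h.left_one, h.right_one]

theorem integrable_integral_section (h : TangentPair A B c) (P : Measure X)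
    [IsProbabilityMeasure P] (κ : Kernel X Y) [IsMarkovKernel κ] (T : TestFunction (X × Y)) :
    Integrable (fun x => ∫ y, A (T (x, y)) ∂κ x) P := by
  have h1 := h.integrable_left T (P.compProd κ)
  rw [Measure.compProd] at h1
  simpa using h1.integral_compProd

theorem integrable_tangentValue_section (h : TangentPair A B c) (P : Measure X)
    [IsProbabilityMeasure P] (κ : Kernel X Y) [IsMarkovKernel κ] (Q : Measure Y)
    [IsProbabilityMeasure Q] (T : TestFunction (X × Y)) :
    Integrable (fun x => tangentValue A B (T.sectionAt x) (κ x) Q) P :=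
  (h.integrable_integral_section P κ T).add
    (h.integrable_right T (P.prod Q)).integral_prod_left

theorem tangentValue_compProd (h : TangentPair A B c) (P : Measure X)
    [IsProbabilityMeasure P] (κ : Kernel X Y) [IsMarkovKernel κ] (Q : Measure Y)
    [IsProbabilityMeasure Q] (T : TestFunction (X × Y)) :
    tangentValue A B T (P.compProd κ) (P.prod Q) =
      ∫ x, tangentValue A B (T.sectionAt x) (κ x) Q ∂P := by
  unfold tangentValue
  rw [Measure.integral_compProd (h.integrable_left T _),
    integral_prod _ (h.integrable_right T _), ← integral_add]
  · rfl
  · exact h.integrable_integral_section P κ T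
  · exact (h.integrable_right T (P.prod Q)).integral_prod_left

/-- Sections of a test function are test functions, so each value on the joint laws is a `P`-average
of values on the fibres. Only monotonicity of the lower integral is used, so `x ↦ dualDivergence A B
(κ x) Q` need not be measurable. -/
theorem dualDivergence_compProd_le (h : TangentPair A B c) (P : Measure X)
    [IsProbabilityMeasure P] (κ : Kernel X Y) [IsMarkovKernel κ] (Q : Measure Y)
    [IsProbabilityMeasure Q] :
    dualDivergence A B (P.compProd κ) (P.prod Q) ≤ ∫⁻ x, dualDivergence A B (κ x) Q ∂P := by
  refine iSup_le fun T => ?_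
  rw [h.tangentValue_compProd]
  have hi := h.integrable_tangentValue_section P κ Q T
  refine (ofReal_integral_le_lintegral_ofReal hi).trans ?_
  · exact lintegral_mono fun x => le_dualDivergence A B (T.sectionAt x) (κ x) Q

/-- With finite support, nearly optimal test functions can be chosen fibre by fibre and glued into
one on the product, without any measurable selection. -/
theorem lintegral_le_dualDivergence_compProd [MeasurableSingletonClass X]
    (h : TangentPair A B c) (P : Measure X)
    [IsProbabilityMeasure P] (κ : Kernel X Y) [IsMarkovKernel κ] (Q : Measure Y)
    [IsProbabilityMeasure Q] (s : Finset X) (hs : P (s : Set X)ᶜ = 0) :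
    ∫⁻ x, dualDivergence A B (κ x) Q ∂P ≤ dualDivergence A B (P.compProd κ) (P.prod Q) := by
  classical
  have hP : P.restrict s = P := Measure.restrict_eq_self_of_ae_mem (by
    rw [ae_iff]; exact hs)
  have h1 : ∫⁻ x, dualDivergence A B (κ x) Q ∂P =
      ∑ x ∈ s, dualDivergence A B (κ x) Q * P {x} := by
    conv_lhs => rw [← hP]
    exact lintegral_finset s _
  have h2 : ∀ x, dualDivergence A B (κ x) Q * P {x} = ⨆ τ : X → TestFunction Y,
      ENNReal.ofReal (tangentValue A B (τ x) (κ x) Q) * P {x} := by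
    intro x
    rw [dualDivergence, ENNReal.iSup_mul]
    refine le_antisymm (iSup_le fun t => ?_) (iSup_le fun τ => ?_)
    · exact le_iSup (fun τ : X → TestFunction Y =>
        ENNReal.ofReal (tangentValue A B (τ x) (κ x) Q) * P {x}) fun _ => t
    · exact le_iSup (fun t : TestFunction Y =>
        ENNReal.ofReal (tangentValue A B t (κ x) Q) * P {x}) (τ x)
  rw [h1]
  simp_rw [h2]
  -- The sum of suprema is the supremum of sums because families `τ` are directed: take the better
  -- of two test functions at each `x`.
  rw [ENNReal.finsetSum_iSup]
  · refine iSup_le fun τ => ?_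
    -- `ENNReal.ofReal` is additive only on nonnegative terms. Where the value is negative, the
    -- constant `1` replaces `τ x`; its value `0` has the same `ENNReal.ofReal`.
    let τ' : X → TestFunction Y := fun x =>
      if 0 ≤ tangentValue A B (τ x) (κ x) Q then τ x else TestFunction.one Y
    have hτ : ∀ x, 0 ≤ tangentValue A B (τ' x) (κ x) Q ∧
        ENNReal.ofReal (tangentValue A B (τ x) (κ x) Q) =
          ENNReal.ofReal (tangentValue A B (τ' x) (κ x) Q) := by
      intro x
      by_cases hx : 0 ≤ tangentValue A B (τ x) (κ x) Q
      · simp [τ', hx]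
      · simp [τ', hx, h.tangentValue_one, (not_le.1 hx).le]
    obtain ⟨T, hT⟩ := TestFunction.exists_of_finset s τ'
    refine le_trans (le_of_eq ?_) (le_dualDivergence A B T _ _)
    have hsec : ∀ x ∈ s, T.sectionAt x = τ' x := fun x hx => Subtype.ext (funext (hT x hx))
    rw [h.tangentValue_compProd]
    have h3 : ∫ x, tangentValue A B (T.sectionAt x) (κ x) Q ∂P =
        ∑ x ∈ s, P.real {x} * tangentValue A B (τ' x) (κ x) Q := by
      conv_lhs => rw [← hP]
      rw [setIntegral_finset s (h.integrable_tangentValue_section P κ Q T).integrableOn]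
      refine Finset.sum_congr rfl fun x hx => ?_
      rw [hsec x hx, smul_eq_mul]
    rw [h3, ENNReal.ofReal_sum_of_nonneg
      (fun x _ => mul_nonneg measureReal_nonneg (hτ x).1)]
    refine Finset.sum_congr rfl fun x _ => ?_
    rw [(hτ x).2, ENNReal.ofReal_mul measureReal_nonneg, ofReal_measureReal, mul_comm]
  · intro τ σ
    refine ⟨fun x => if tangentValue A B (τ x) (κ x) Q ≤ tangentValue A B (σ x) (κ x) Q then σ x
      else τ x, fun x => ?_⟩
    beta_reduce
    split_ifs with hx
    · exact ⟨by gcongr, le_rfl⟩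
    · exact ⟨le_rfl, by gcongr; exact (not_le.1 hx).le⟩

theorem dualDivergence_compProd [MeasurableSingletonClass X]
    (h : TangentPair A B c) (P : Measure X)
    [IsProbabilityMeasure P] (κ : Kernel X Y) [IsMarkovKernel κ] (Q : Measure Y)
    [IsProbabilityMeasure Q] (s : Finset X) (hs : P (s : Set X)ᶜ = 0) :
    dualDivergence A B (P.compProd κ) (P.prod Q) = ∫⁻ x, dualDivergence A B (κ x) Q ∂P :=
  (h.dualDivergence_compProd_le P κ Q).antisymm (h.lintegral_le_dualDivergence_compProd P κ Q s hs)

theorem tangentValue_ofSet (h : TangentPair A B c) (W Q : Measure Y) (S : Set Y)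
    (hS : MeasurableSet S) (s : ℝ) (hs : 0 < s) :
    tangentValue A B (TestFunction.ofSet S hS s hs) W Q = A s * W.real S + B s * Q.real S := by
  have key : ∀ F : ℝ → ℝ, F 1 = 0 → ∀ W : Measure Y,
      ∫ y, F (TestFunction.ofSet S hS s hs y) ∂W = F s * W.real S := by
    intro F hF W
    have : (fun y => F (TestFunction.ofSet S hS s hs y)) = S.indicator fun _ => F s := by
      ext y
      by_cases hy : y ∈ S <;> simp [TestFunction.ofSet, hy, hF]
    rw [this, integral_indicator_const _ hS, smul_eq_mul, mul_comm]
  rw [tangentValue, key A h.left_one, key B h.right_one]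

/-- The test function equal to `1 + s` on `S` and `1` elsewhere has value `s * c * (W S - Q S)` to
first order in `s`, so a small divergence bounds this difference for all `S` at once. -/
theorem exists_forall_abs_sub_le (h : TangentPair A B c) {ε : ℝ} (hε : 0 < ε) :
    ∃ δ : ℝ, 0 < δ ∧ ∀ (W Q : Measure Y) [IsProbabilityMeasure W] [IsProbabilityMeasure Q],
      dualDivergence A B W Q ≤ ENNReal.ofReal δ → ∀ S, MeasurableSet S → |W.real S - Q.real S| ≤ ε := by
  have hc := h.pos
  have hη : 0 < c * ε / 4 := by positivity
  have h1 := (hasDerivAt_iff_isLittleO.1 h.hasDerivAt_left).bound hη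
  have h2 := (hasDerivAt_iff_isLittleO.1 h.hasDerivAt_right).bound hη
  obtain ⟨r, hr, hball⟩ := Metric.eventually_nhds_iff.1 (h1.and h2)
  set s := r / 2 with hs
  have hs0 : 0 < s := by positivity
  have hb := hball (y := 1 + s) (by rw [Real.dist_eq]; simp [abs_of_pos hs0]; linarith)
  simp only [h.left_one, h.right_one, add_sub_cancel_left, smul_eq_mul, sub_zero,
    Real.norm_eq_abs, abs_of_pos hs0] at hb
  have hA := (abs_le.1 hb.1).1
  have hB := (abs_le.1 hb.2).1
  -- The two first-order errors are at most `s * c * ε / 4` each; `δ` takes the other half of `s * c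
  -- * ε`.
  refine ⟨s * c * ε / 2, by positivity, fun W Q _ _ hWQ => ?_⟩
  have key : ∀ S, MeasurableSet S → W.real S - Q.real S ≤ ε := by
    intro S hS
    have h3 := (le_dualDivergence A B (TestFunction.ofSet S hS (1 + s) (by linarith)) W Q).trans
      hWQ
    rw [ENNReal.ofReal_le_ofReal_iff (by positivity), h.tangentValue_ofSet] at h3
    have hW0 : 0 ≤ W.real S := measureReal_nonneg
    have hQ0 : 0 ≤ Q.real S := measureReal_nonneg
    have hW1 : W.real S ≤ 1 := measureReal_le_one
    have hQ1 : Q.real S ≤ 1 := measureReal_le_one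
    have h4 : (s * c - c * ε / 4 * s) * W.real S ≤ A (1 + s) * W.real S :=
      mul_le_mul_of_nonneg_right (by linarith) hW0
    have h5 : (- (s * c) - c * ε / 4 * s) * Q.real S ≤ B (1 + s) * Q.real S :=
      mul_le_mul_of_nonneg_right (by linarith) hQ0
    have h6 : c * ε / 4 * s * W.real S ≤ c * ε / 4 * s :=
      mul_le_of_le_one_right (by positivity) hW1
    have h7 : c * ε / 4 * s * Q.real S ≤ c * ε / 4 * s :=
      mul_le_of_le_one_right (by positivity) hQ1
    have h8 : s * c * (W.real S - Q.real S) ≤ s * c * ε := by nlinarith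
    exact le_of_mul_le_mul_left h8 (by positivity)
  intro S hS
  rw [abs_le]
  refine ⟨?_, key S hS⟩
  have h3 := key Sᶜ hS.compl
  rw [probReal_compl_eq_one_sub hS, probReal_compl_eq_one_sub hS] at h3
  linarith

end TangentPair

/-! ### Total variation: bounded integrals, lower semicontinuity, completeness -/

theorem abs_integral_sub_integral_le {Y : Type*} [MeasurableSpace Y] (W Q : Measure Y)
    [IsProbabilityMeasure W] [IsProbabilityMeasure Q] {ε M : ℝ} (hM : 0 ≤ M)
    (hWQ : ∀ S, MeasurableSet S → |W.real S - Q.real S| ≤ ε) {f : Y → ℝ} (hf : Measurable f)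
    (hfM : ∀ y, |f y| ≤ M) : |∫ y, f y ∂W - ∫ y, f y ∂Q| ≤ ε * (2 * M) := by
  have key : ∀ (W : Measure Y) [IsProbabilityMeasure W],
      ∫ y, f y ∂W = (∫ t in Set.Ioc 0 (2 * M), W.real {y | t ≤ f y + M}) - M ∧
        IntegrableOn (fun t => W.real {y | t ≤ f y + M}) (Set.Ioc 0 (2 * M)) := by
    intro W _
    have hi : Integrable f W := Integrable.of_bound hf.aestronglyMeasurable M (ae_of_all _ hfM)
    -- Layer-cake formula for `f + M`, which takes values in `[0, 2 * M]`: both integrals become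
    -- integrals of measures of the same superlevel sets.
    have h1 : ∫ y, (f y + M) ∂W = ∫ t in Set.Ioc 0 (2 * M), W.real {y | t ≤ f y + M} :=
      (hi.add (integrable_const M)).integral_eq_integral_Ioc_meas_le (M := 2 * M)
      (ae_of_all _ fun y => by
        have := (abs_le.1 (hfM y)).1
        simp; linarith)
      (ae_of_all _ fun y => by
        have := (abs_le.1 (hfM y)).2
        simp; linarith)
    have h2 : ∫ y, (f y + M) ∂W = ∫ y, f y ∂W + M := by
      rw [integral_add hi (integrable_const M)]
      simp
    refine ⟨by rw [h2] at h1; linarith, ?_⟩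
    have hanti : Antitone fun t => W.real {y | t ≤ f y + M} := fun a b hab =>
      measureReal_mono fun y hy => hab.trans hy
    exact Integrable.of_bound hanti.measurable.aestronglyMeasurable 1
      (ae_of_all _ fun t => by
        rw [Real.norm_of_nonneg measureReal_nonneg]; exact measureReal_le_one)
  rw [(key W).1, (key Q).1, sub_sub_sub_cancel_right, ← integral_sub (key W).2 (key Q).2,
    ← Real.norm_eq_abs]
  refine (norm_setIntegral_le_of_norm_le_const (C := ε) (by simp [ENNReal.mul_lt_top]) fun t _ => ?_).trans ?_
  · exact hWQ _ (measurableSet_le measurable_const (hf.add_const M))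
  · simp [hM]

/-- For a fixed test function, `Q` enters only through the integral of a bounded function, which is
continuous in total variation; a supremum of such functions is lower semicontinuous. -/
theorem TangentPair.dualDivergence_le_of_tendsto {Y : Type*} [MeasurableSpace Y] {A B : ℝ → ℝ}
    {c : ℝ} (h : TangentPair A B c) (W Q : Measure Y) [IsProbabilityMeasure W]
    [IsProbabilityMeasure Q] (a : ℝ≥0∞)
    (happrox : ∀ ε : ℝ, 0 < ε → ∃ Q' : Measure Y, IsProbabilityMeasure Q' ∧
      (∀ S, MeasurableSet S → |Q'.real S - Q.real S| ≤ ε) ∧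
        dualDivergence A B W Q' ≤ a + ENNReal.ofReal ε) :
    dualDivergence A B W Q ≤ a := by
  rcases eq_or_ne a ∞ with rfl | ha
  · exact le_top
  refine iSup_le fun t => ENNReal.ofReal_le_of_le_toReal ?_
  obtain ⟨M, hM⟩ := t.exists_forall_mem_Icc (.inr h.antitone)
  have hM' : ∀ y, |B (t y)| ≤ |M| := fun y => (hM y).trans (le_abs_self M)
  refine le_of_forall_pos_le_add fun η hη => ?_
  -- At accuracy `ε` the divergence bound loses `ε` and the change of measure loses `2 * |M| * ε`;
  -- together they must equal `η`.
  have hd : 0 < 1 + 2 * |M| := by positivity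
  obtain ⟨Q', _, h1, h2⟩ := happrox (η / (1 + 2 * |M|)) (by positivity)
  have h3 := abs_integral_sub_integral_le Q' Q (abs_nonneg M) h1
    (h.measurable_right.comp t.measurable) hM'
  have h4 := (le_dualDivergence A B t W Q').trans h2
  rw [← ENNReal.ofReal_toReal ha, ← ENNReal.ofReal_add ENNReal.toReal_nonneg (by positivity),
    ENNReal.ofReal_le_ofReal_iff (by positivity)] at h4
  have h5 := (abs_le.1 h3).1
  have h6 : η / (1 + 2 * |M|) + η / (1 + 2 * |M|) * (2 * |M|) = η := by field_simp
  simp only [tangentValue, Function.comp_apply] at *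
  linarith

/-- Setwise limits exist by completeness of the reals, and convergence that is uniform over sets
carries countable additivity to the limit. -/
theorem exists_probabilityMeasure_tendsto {Y : Type*} [MeasurableSpace Y]
    (Q : ℕ → ProbabilityMeasure Y)
    (hQ : ∀ ε : ℝ, 0 < ε → ∃ N, ∀ n ≥ N, ∀ m ≥ N, ∀ S, MeasurableSet S →
      |(Q n : Measure Y).real S - (Q m : Measure Y).real S| ≤ ε) :
    ∃ q : ProbabilityMeasure Y, ∀ ε : ℝ, 0 < ε → ∃ N, ∀ n ≥ N, ∀ S, MeasurableSet S →
      |(Q n : Measure Y).real S - (q : Measure Y).real S| ≤ ε := by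
  have hlim : ∀ S : Set Y, ∃ l : ℝ, MeasurableSet S →
      Tendsto (fun n => (Q n : Measure Y).real S) atTop (𝓝 l) := by
    intro S
    by_cases hS : MeasurableSet S
    · have : CauchySeq fun n => (Q n : Measure Y).real S := by
        refine Metric.cauchySeq_iff.2 fun ε hε => ?_
        obtain ⟨N, hN⟩ := hQ (ε / 2) (by positivity)
        exact ⟨N, fun m hm n hn => (hN m hm n hn S hS).trans_lt (by linarith)⟩
      obtain ⟨l, hl⟩ := cauchySeq_tendsto_of_complete this
      exact ⟨l, fun _ => hl⟩
    · exact ⟨0, fun h => absurd h hS⟩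
  choose l hl using hlim
  have hunif : ∀ ε : ℝ, 0 < ε → ∃ N, ∀ n ≥ N, ∀ S, MeasurableSet S →
      |(Q n : Measure Y).real S - l S| ≤ ε := by
    intro ε hε
    obtain ⟨N, hN⟩ := hQ ε hε
    refine ⟨N, fun n hn S hS => ?_⟩
    refine le_of_tendsto ((hl S hS).const_sub ((Q n : Measure Y).real S)).abs ?_
    filter_upwards [eventually_ge_atTop N] with m hm using hN n hn m hm S hS
  have hl0 : ∀ S, MeasurableSet S → 0 ≤ l S := fun S hS =>
    ge_of_tendsto' (hl S hS) fun n => measureReal_nonneg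
  have hl_empty : l ∅ = 0 := by
    refine tendsto_nhds_unique (hl ∅ .empty) ?_
    simp
  have hl_univ : l Set.univ = 1 := by
    refine tendsto_nhds_unique (hl _ .univ) ?_
    simp
  have hl_sum : ∀ f : ℕ → Set Y, (∀ i, MeasurableSet (f i)) → Pairwise (Function.onFun Disjoint f) →
      HasSum (fun i => l (f i)) (l (⋃ i, f i)) := by
    intro f hf hd
    rw [hasSum_iff_tendsto_nat_of_nonneg fun i => hl0 _ (hf i)]
    have hfin : ∀ n k, ∑ i ∈ Finset.range k, (Q n : Measure Y).real (f i) =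
        (Q n : Measure Y).real (⋃ i ∈ Finset.range k, f i) := fun n k =>
      (measureReal_biUnion_finset (fun i _ j _ hij => hd hij) fun i _ => hf i).symm
    have hfinl : ∀ k, ∑ i ∈ Finset.range k, l (f i) = l (⋃ i ∈ Finset.range k, f i) := by
      intro k
      refine tendsto_nhds_unique (tendsto_finsetSum _ fun i _ => hl (f i) (hf i)) ?_
      simp_rw [hfin]
      exact hl _ (Finset.measurableSet_biUnion _ fun i _ => hf i)
    -- Three errors of `ε / 4`: the limit against one fixed `Q n` on a partial union and on the full
    -- union, and the tail of the series for `Q n`.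
    refine Metric.tendsto_atTop.2 fun ε hε => ?_
    obtain ⟨n, hn⟩ := hunif (ε / 4) (by positivity)
    have hn' := hn n le_rfl
    have hQn : HasSum (fun i => (Q n : Measure Y).real (f i))
        ((Q n : Measure Y).real (⋃ i, f i)) := by
      have h1 := measure_iUnion (μ := (Q n : Measure Y)) hd hf
      rw [measureReal_def, h1, ENNReal.tsum_toReal_eq fun i => measure_ne_top _ _]
      exact ENNReal.hasSum_toReal (by rw [← h1]; exact measure_ne_top _ _)
    obtain ⟨K, hK⟩ := Metric.tendsto_atTop.1 hQn.tendsto_sum_nat (ε / 4) (by positivity)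
    refine ⟨K, fun k hk => ?_⟩
    have h1 := hK k hk
    rw [hfin, Real.dist_eq, abs_lt] at h1
    rw [hfinl, Real.dist_eq, abs_lt]
    have h2 := abs_le.1 (hn' _ (Finset.measurableSet_biUnion (Finset.range k) fun i _ => hf i))
    have h3 := abs_le.1 (hn' _ (MeasurableSet.iUnion hf))
    constructor <;> linarith [h1.1, h1.2, h2.1, h2.2, h3.1, h3.2]
  let q : Measure Y := Measure.ofMeasurable (fun S _ => ENNReal.ofReal (l S)) (by simp [hl_empty])
    fun f hf hd => by
      rw [← (hl_sum f hf hd).tsum_eq, ENNReal.ofReal_tsum_of_nonneg (fun i => hl0 _ (hf i))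
        (hl_sum f hf hd).summable]
  have hq : ∀ S, MeasurableSet S → q S = ENNReal.ofReal (l S) := fun S hS =>
    Measure.ofMeasurable_apply S hS
  refine ⟨⟨q, ⟨by rw [hq _ .univ, hl_univ, ENNReal.ofReal_one]⟩⟩, fun ε hε => ?_⟩
  obtain ⟨N, hN⟩ := hunif ε hε
  refine ⟨N, fun n hn S hS => ?_⟩
  have : q.real S = l S := by rw [measureReal_def, hq S hS, ENNReal.toReal_ofReal (hl0 S hS)]
  simpa [this] using hN n hn S hS

/-! ### Finitely supported priors and the limit of their centers -/

/-- Probability measures concentrated on a finite set. -/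
def FinitePrior (X : Type*) [MeasurableSpace X] : Type _ :=
  {P : ProbabilityMeasure X // ∃ s : Finset X, (P : Measure X) (s : Set X)ᶜ = 0}

namespace FinitePrior

variable {X : Type*} [MeasurableSpace X]

/-- The underlying measure of a finitely supported prior. -/
def toMeasure (P : FinitePrior X) : Measure X := (P.1 : Measure X)

instance (P : FinitePrior X) : IsProbabilityMeasure P.toMeasure :=
  inferInstanceAs (IsProbabilityMeasure (P.1 : Measure X))

/-- The point mass at `x`. -/
noncomputable def dirac [MeasurableSingletonClass X] (x : X) : FinitePrior X :=
  ⟨⟨Measure.dirac x, inferInstance⟩, {x}, by simp⟩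

theorem lintegral_dirac [MeasurableSingletonClass X] (x : X) (f : X → ℝ≥0∞) : ∫⁻ y, f y ∂(dirac x).toMeasure = f x :=
  MeasureTheory.lintegral_dirac x f

/-- Arbitrary `f` are allowed because the divergence from `κ x`, as a function of `x`, is a supremum
over an uncountable family whose measurability is not established. -/
theorem exists_mix (P P' : FinitePrior X) (a b : ℝ≥0∞) (hab : a + b = 1) :
    ∃ M : FinitePrior X, ∀ f : X → ℝ≥0∞, ∫⁻ x, f x ∂M.toMeasure =
      a * ∫⁻ x, f x ∂P.toMeasure + b * ∫⁻ x, f x ∂P'.toMeasure := by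
  classical
  obtain ⟨s, hs⟩ := P.2
  obtain ⟨u, hu⟩ := P'.2
  have hs' : P.toMeasure (s : Set X)ᶜ = 0 := hs
  have hu' : P'.toMeasure (u : Set X)ᶜ = 0 := hu
  refine ⟨⟨⟨a • P.toMeasure + b • P'.toMeasure, ⟨by simp [hab]⟩⟩, s ∪ u, ?_⟩, fun f => ?_⟩
  · have h1 : P.toMeasure ((s ∪ u : Finset X) : Set X)ᶜ = 0 :=
      measure_mono_null (Set.compl_subset_compl.2 (by simp)) hs'
    have h2 : P'.toMeasure ((s ∪ u : Finset X) : Set X)ᶜ = 0 :=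
      measure_mono_null (Set.compl_subset_compl.2 (by simp)) hu'
    simp only [ProbabilityMeasure.coe_mk, Measure.coe_add, Measure.coe_smul, Pi.add_apply,
      Pi.smul_apply, h1, h2, smul_zero, add_zero]
  · change ∫⁻ x, f x ∂(a • P.toMeasure + b • P'.toMeasure) = _
    rw [lintegral_add_measure, lintegral_smul_measure, lintegral_smul_measure, smul_eq_mul,
      smul_eq_mul]

end FinitePrior

section Center

variable {X Y : Type*} [MeasurableSpace X] [MeasurableSpace Y]
  {A B : ℝ → ℝ} {c : ℝ} {V : X → ProbabilityMeasure Y → ℝ≥0∞}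
  {center : FinitePrior X → ProbabilityMeasure Y} {b C : ℝ≥0∞}

/-- Mixing a nearly optimal prior with another prior moves its center only slightly and bounds the
value of the other prior. -/
theorem exists_mixed_center
    (hcenter : ∀ (P : FinitePrior X) (Q : ProbabilityMeasure Y),
      ∫⁻ x, V x (center P) ∂P.toMeasure + b * dualDivergence A B (center P : Measure Y) Q ≤
        ∫⁻ x, V x Q ∂P.toMeasure)
    (hC : ∀ P : FinitePrior X, ∫⁻ x, V x (center P) ∂P.toMeasure ≤ C)
    (hCtop : C ≠ ∞) (hb : b ≠ 0) (hbtop : b ≠ ∞) {η δ : ℝ} (hη : 0 < η) (hδ : 0 < δ) :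
    ∃ ε : ℝ, 0 < ε ∧ ∀ P : FinitePrior X,
      C ≤ ∫⁻ x, V x (center P) ∂P.toMeasure + ENNReal.ofReal ε → ∀ P' : FinitePrior X,
        ∃ Q : ProbabilityMeasure Y,
          dualDivergence A B (center P : Measure Y) Q ≤ ENNReal.ofReal δ ∧
          ∫⁻ x, V x Q ∂P'.toMeasure ≤ C + ENNReal.ofReal η := by
  have hb0 : 0 < b.toReal := ENNReal.toReal_pos hb hbtop
  have hC0 : 0 ≤ C.toReal := ENNReal.toReal_nonneg
  -- The weight `β` of `P'` is small enough that `β * C` uses at most a quarter of `δ * b`; the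
  -- optimality gap `ε` uses at most another quarter, and `1 - β ≥ 1 / 2` absorbs the remaining
  -- factor.
  obtain ⟨β, hβ0, hβ1, hβC⟩ : ∃ β : ℝ, 0 < β ∧ β ≤ 1 / 2 ∧ β * C.toReal ≤ δ * b.toReal / 4 := by
    refine ⟨min (1 / 2) (δ * b.toReal / 4 / (C.toReal + 1)), by positivity, min_le_left _ _, ?_⟩
    calc _ ≤ δ * b.toReal / 4 / (C.toReal + 1) * (C.toReal + 1) :=
          mul_le_mul (min_le_right _ _) (by linarith) hC0 (by positivity)
      _ = _ := by field_simp
  refine ⟨min (β * η) (δ * b.toReal / 4), by positivity, fun P hP P' => ?_⟩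
  set ε := min (β * η) (δ * b.toReal / 4) with hε
  have hε0 : 0 < ε := by positivity
  obtain ⟨M, hM⟩ := FinitePrior.exists_mix P P' (ENNReal.ofReal (1 - β)) (ENNReal.ofReal β) (by
    rw [← ENNReal.ofReal_add (by linarith) hβ0.le]; simp)
  set Q := center M
  set a := ∫⁻ x, V x (center P) ∂P.toMeasure
  set j := dualDivergence A B (center P : Measure Y) Q
  set v := ∫⁻ x, V x Q ∂P'.toMeasure
  -- The average for the mixture at its own center is at most `C`, and the Pythagorean inequality
  -- bounds the part coming from `P`. Dropping `v` from this bounds `j`; dropping `j` bounds `v`.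
  have key : ENNReal.ofReal (1 - β) * (a + b * j) + ENNReal.ofReal β * v ≤ C := by
    refine le_trans ?_ (hC M)
    rw [hM]
    gcongr
    exact hcenter P Q
  have hβ' : ENNReal.ofReal β ≠ 0 := by simpa using hβ0
  have hβ'' : ENNReal.ofReal (1 - β) ≠ 0 := by simp; linarith
  have hatop : a ≠ ∞ := ne_top_of_le_ne_top hCtop (hC P)
  have hktop := ne_top_of_le_ne_top hCtop key
  have hvtop : v ≠ ∞ := fun h => by simp [h, ENNReal.mul_top hβ'] at hktop
  have hjtop : j ≠ ∞ := fun h => by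
    simp [h, ENNReal.mul_top hb, ENNReal.mul_top hβ''] at hktop
  rw [← ENNReal.ofReal_toReal hatop, ← ENNReal.ofReal_toReal hvtop,
    ← ENNReal.ofReal_toReal hjtop, ← ENNReal.ofReal_toReal hbtop, ← ENNReal.ofReal_toReal hCtop,
    ← ENNReal.ofReal_mul (by positivity), ← ENNReal.ofReal_mul hβ0.le,
    ← ENNReal.ofReal_add (by positivity) (by positivity), ← ENNReal.ofReal_mul (by linarith),
    ← ENNReal.ofReal_add (mul_nonneg (by linarith) (by positivity)) (by positivity),
    ENNReal.ofReal_le_ofReal_iff hC0] at key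
  rw [← ENNReal.ofReal_toReal hatop, ← ENNReal.ofReal_toReal hCtop,
    ← ENNReal.ofReal_add (by positivity) (by positivity),
    ENNReal.ofReal_le_ofReal_iff (by positivity)] at hP
  have ha0 : 0 ≤ a.toReal := ENNReal.toReal_nonneg
  have hj0 : 0 ≤ j.toReal := ENNReal.toReal_nonneg
  have hv0 : 0 ≤ v.toReal := ENNReal.toReal_nonneg
  have hε1 : ε ≤ β * η := min_le_left _ _
  have hε2 : ε ≤ δ * b.toReal / 4 := min_le_right _ _
  have h1 : (1 - β) * (C.toReal - ε) ≤ (1 - β) * a.toReal :=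
    mul_le_mul_of_nonneg_left (by linarith) (by linarith)
  have h2 : 0 ≤ β * ε := by positivity
  have h3 : 0 ≤ (1 - β) * (b.toReal * j.toReal) := mul_nonneg (by linarith) (by positivity)
  have h4 : 0 ≤ β * v.toReal := by positivity
  refine ⟨Q, ?_, ?_⟩
  · change j ≤ _
    rw [← ENNReal.ofReal_toReal hjtop]
    refine ENNReal.ofReal_le_ofReal ?_
    have h5 : 1 / 2 * (b.toReal * j.toReal) ≤ (1 - β) * (b.toReal * j.toReal) :=
      mul_le_mul_of_nonneg_right (by linarith) (by positivity)
    have h6 : b.toReal * j.toReal ≤ b.toReal * δ := by nlinarith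
    exact le_of_mul_le_mul_left h6 hb0
  · change v ≤ _
    rw [← ENNReal.ofReal_toReal hvtop, ← ENNReal.ofReal_toReal hCtop,
      ← ENNReal.ofReal_add (by positivity) (by positivity)]
    refine ENNReal.ofReal_le_ofReal ?_
    have h6 : β * v.toReal ≤ β * (C.toReal + η) := by nlinarith
    exact le_of_mul_le_mul_left h6 hβ0

/-- The center is the total variation limit of the centers of a maximising sequence; `hcenter` is
the Pythagorean inequality that controls it. -/
theorem TangentPair.exists_unique_center (h : TangentPair A B c) (κ : Kernel X Y)
    [MeasurableSingletonClass X] [IsMarkovKernel κ] [Nonempty X]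
    (hcenter : ∀ (P : FinitePrior X) (Q : ProbabilityMeasure Y),
      ∫⁻ x, dualDivergence A B (κ x) (center P) ∂P.toMeasure +
          b * dualDivergence A B (center P : Measure Y) Q ≤
        ∫⁻ x, dualDivergence A B (κ x) Q ∂P.toMeasure)
    (hC : ⨆ P : FinitePrior X, ∫⁻ x, dualDivergence A B (κ x) (center P) ∂P.toMeasure = C)
    (hCtop : C ≠ ∞) (hb : b ≠ 0) (hbtop : b ≠ ∞) :
    ∃ q : ProbabilityMeasure Y, (∀ x, dualDivergence A B (κ x) q ≤ C) ∧
      ∀ q' : ProbabilityMeasure Y, (∀ x, dualDivergence A B (κ x) q' ≤ C) → q' = q := by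
  have hle : ∀ P : FinitePrior X,
      ∫⁻ x, dualDivergence A B (κ x) (center P) ∂P.toMeasure ≤ C := fun P =>
    hC ▸ le_iSup (fun P : FinitePrior X =>
      ∫⁻ x, dualDivergence A B (κ x) (center P) ∂P.toMeasure) P
  have : Nonempty (FinitePrior X) := ⟨FinitePrior.dirac (Classical.arbitrary X)⟩
  have hnear : ∀ n : ℕ, ∃ P : FinitePrior X,
      C ≤ ∫⁻ x, dualDivergence A B (κ x) (center P) ∂P.toMeasure +
        ENNReal.ofReal (1 / ((n : ℝ) + 1)) := by
    intro n
    rcases eq_or_ne C 0 with hC0 | hC0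
    · exact ⟨Classical.arbitrary _, by simp [hC0]⟩
    · have hn : ENNReal.ofReal (1 / ((n : ℝ) + 1)) ≠ 0 := by
        rw [Ne, ENNReal.ofReal_eq_zero, not_le]; positivity
      have h1 := ENNReal.sub_lt_self hCtop hC0 hn
      conv_rhs at h1 => rw [← hC]
      obtain ⟨P, hP⟩ := lt_iSup_iff.1 h1
      exact ⟨P, tsub_le_iff_right.1 hP.le⟩
  choose P hP using hnear
  have hlarge : ∀ ε : ℝ, 0 < ε → ∃ N : ℕ, ∀ n ≥ N,
      C ≤ ∫⁻ x, dualDivergence A B (κ x) (center (P n)) ∂(P n).toMeasure + ENNReal.ofReal ε := by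
    intro ε hε
    obtain ⟨N, hN⟩ := exists_nat_one_div_lt hε
    refine ⟨N, fun n hn => (hP n).trans ?_⟩
    gcongr
    exact (Nat.one_div_le_one_div hn).trans hN.le
  have hclose : ∀ ε : ℝ, 0 < ε → ∀ δ : ℝ, 0 < δ → ε ≤ b.toReal * δ → ∀ (P' : FinitePrior X)
      (Q : ProbabilityMeasure Y),
      ∫⁻ x, dualDivergence A B (κ x) Q ∂P'.toMeasure ≤
        ∫⁻ x, dualDivergence A B (κ x) (center P') ∂P'.toMeasure + ENNReal.ofReal ε →
      dualDivergence A B (center P' : Measure Y) Q ≤ ENNReal.ofReal δ := by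
    intro ε hε δ hδ hεδ P' Q hQ
    have h1 := (hcenter P' Q).trans hQ
    rw [ENNReal.add_le_add_iff_left (ne_top_of_le_ne_top hCtop (hle P'))] at h1
    have h2 := h1.trans (ENNReal.ofReal_le_ofReal hεδ)
    rwa [ENNReal.ofReal_mul ENNReal.toReal_nonneg, ENNReal.ofReal_toReal hbtop,
      ENNReal.mul_le_mul_iff_right hb hbtop] at h2
  have hb0 : 0 < b.toReal := ENNReal.toReal_pos hb hbtop
  obtain ⟨q, hq⟩ := exists_probabilityMeasure_tendsto (fun n => center (P n)) (by
    intro ε hε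
    obtain ⟨δ, hδ, hδε⟩ := h.exists_forall_abs_sub_le (Y := Y) (half_pos hε)
    have hbδ : 0 < b.toReal * δ / 2 := by positivity
    obtain ⟨ε', hε', hmix⟩ := exists_mixed_center hcenter hle hCtop hb hbtop hbδ hδ
    obtain ⟨N, hN⟩ := hlarge _ (lt_min hε' hbδ)
    refine ⟨N, fun n hn m hm S hS => ?_⟩
    -- `Q` is close to the center of `P n` by mixing. Its average for the nearly optimal `P m` is
    -- nearly minimal, so the Pythagorean inequality also puts it close to the center of `P m`.
    obtain ⟨Q, hQ1, hQ2⟩ := hmix (P n) ((hN n hn).trans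
      (add_le_add le_rfl (ENNReal.ofReal_le_ofReal (min_le_left _ _)))) (P m)
    have h1 : dualDivergence A B (center (P m) : Measure Y) Q ≤ ENNReal.ofReal δ := by
      refine hclose (b.toReal * δ) (by positivity) δ hδ le_rfl (P m) Q (hQ2.trans ?_)
      have h2 := ENNReal.ofReal_add hbδ.le hbδ.le
      rw [add_halves] at h2
      rw [h2, ← add_assoc]
      gcongr
      exact (hN m hm).trans (add_le_add le_rfl (ENNReal.ofReal_le_ofReal (min_le_right _ _)))
    have h2 := abs_le.1 (hδε _ _ hQ1 S hS)
    have h3 := abs_le.1 (hδε _ _ h1 S hS)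
    rw [abs_le]
    constructor <;> linarith [h2.1, h2.2, h3.1, h3.2])
  refine ⟨q, fun x => ?_, fun q' hq' => ?_⟩
  · refine h.dualDivergence_le_of_tendsto _ _ C fun ε hε => ?_
    obtain ⟨δ, hδ, hδε⟩ := h.exists_forall_abs_sub_le (Y := Y) (half_pos hε)
    obtain ⟨ε', hε', hmix⟩ := exists_mixed_center hcenter hle hCtop hb hbtop hε hδ
    obtain ⟨N, hN⟩ := hlarge _ hε'
    obtain ⟨N', hN'⟩ := hq _ (half_pos hε)
    -- Mixing with the point mass at `x` gives a `Q` close to `q` with divergence from `κ x` at most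
    -- `C + ε`, as lower semicontinuity requires.
    obtain ⟨Q, hQ1, hQ2⟩ := hmix (P (max N N')) (hN _ (le_max_left _ _)) (FinitePrior.dirac x)
    rw [FinitePrior.lintegral_dirac] at hQ2
    refine ⟨Q, inferInstance, fun S hS => ?_, hQ2⟩
    have h2 := abs_le.1 (hδε _ _ hQ1 S hS)
    have h3 := abs_le.1 (hN' _ (le_max_right N N') S hS)
    rw [abs_le]
    constructor <;> linarith [h2.1, h2.2, h3.1, h3.2]
  · refine Subtype.ext (Measure.ext fun S hS => ?_)
    change (q' : Measure Y) S = (q : Measure Y) S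
    rw [← measureReal_eq_measureReal_iff]
    refine eq_of_abs_sub_nonpos (le_of_forall_pos_le_add fun ε hε => ?_)
    rw [zero_add]
    obtain ⟨δ, hδ, hδε⟩ := h.exists_forall_abs_sub_le (Y := Y) (half_pos hε)
    obtain ⟨N, hN⟩ := hlarge (b.toReal * δ) (by positivity)
    obtain ⟨N', hN'⟩ := hq _ (half_pos hε)
    -- The average of the divergences to `q'` is at most `C`, hence nearly minimal for a late prior,
    -- so `q'` is close to the center of that prior.
    have h1 := hclose (b.toReal * δ) (by positivity) δ hδ le_rfl (P (max N N')) q'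
      (le_trans ((lintegral_mono hq').trans (by simp)) (hN _ (le_max_left _ _)))
    have h2 := abs_le.1 (hδε _ _ h1 S hS)
    have h3 := abs_le.1 (hN' _ (le_max_right N N') S hS)
    refine abs_le.2 ?_
    constructor <;> linarith [h2.1, h2.2, h3.1, h3.2]

end Center

/-! ### Evaluating a variational divergence from densities -/

/-- Truncation of `r` to the interval `[1 / (n + 1), n + 1]`. -/
noncomputable def truncation (n : ℕ) (r : ℝ≥0∞) : ℝ :=
  (max ((n : ℝ≥0∞) + 1)⁻¹ (min ((n : ℝ≥0∞) + 1) r)).toReal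

theorem measurable_truncation (n : ℕ) : Measurable (truncation n) := by
  unfold truncation
  fun_prop

theorem truncation_of_ne_top (n : ℕ) {r : ℝ≥0∞} (hr : r ≠ ∞) :
    truncation n r = max ((n : ℝ) + 1)⁻¹ (min ((n : ℝ) + 1) r.toReal) := by
  have h1 : (n : ℝ≥0∞) + 1 ≠ ∞ := by simp
  have h2 : ((n : ℝ≥0∞) + 1).toReal = (n : ℝ) + 1 := by
    rw [ENNReal.toReal_add (by simp) (by simp)]; simp
  have h3 : ((n : ℝ≥0∞) + 1)⁻¹ ≠ ∞ := by simp
  rw [truncation, ENNReal.toReal_max h3 (ne_top_of_le_ne_top h1 (min_le_left _ _)),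
    ENNReal.toReal_min h1 hr, ENNReal.toReal_inv, h2]

theorem inv_le_self_nat (n : ℕ) : ((n : ℝ) + 1)⁻¹ ≤ (n : ℝ) + 1 := by
  have h1 : (1 : ℝ) ≤ (n : ℝ) + 1 := by
    have : (0 : ℝ) ≤ n := n.cast_nonneg
    linarith
  exact (inv_le_one_of_one_le₀ h1).trans h1

theorem truncation_zero (n : ℕ) : truncation n 0 = ((n : ℝ) + 1)⁻¹ := by
  rw [truncation_of_ne_top n ENNReal.zero_ne_top, ENNReal.toReal_zero, min_eq_right (by positivity),
    max_eq_left (by positivity)]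

theorem truncation_top (n : ℕ) : truncation n ∞ = (n : ℝ) + 1 := by
  have h1 : ((n : ℝ≥0∞) + 1)⁻¹ ≤ (n : ℝ≥0∞) + 1 :=
    (ENNReal.inv_le_one.2 le_add_self).trans le_add_self
  rw [truncation, min_eq_left le_top, max_eq_right h1, ENNReal.toReal_add (by simp) (by simp)]
  simp

theorem eventually_truncation_eq {r : ℝ≥0∞} (h0 : r ≠ 0) (hr : r ≠ ∞) :
    ∀ᶠ n : ℕ in atTop, truncation n r = r.toReal := by
  have hpos : 0 < r.toReal := ENNReal.toReal_pos h0 hr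
  filter_upwards [eventually_ge_atTop ⌈r.toReal⌉₊, eventually_ge_atTop ⌈r.toReal⁻¹⌉₊] with n h1 h2
  have h3 : r.toReal ≤ (n : ℝ) := (Nat.le_ceil _).trans (by exact_mod_cast h1)
  have h4 : r.toReal⁻¹ ≤ (n : ℝ) := (Nat.le_ceil _).trans (by exact_mod_cast h2)
  rw [truncation_of_ne_top n hr, min_eq_right (by linarith), max_eq_right]
  rw [inv_le_comm₀ (by positivity) hpos]
  linarith

theorem truncation_mem_Icc (n : ℕ) (r : ℝ≥0∞) :
    truncation n r ∈ Set.Icc ((n : ℝ) + 1)⁻¹ ((n : ℝ) + 1) := by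
  rcases eq_or_ne r ∞ with rfl | hr
  · rw [truncation_top]
    exact ⟨inv_le_self_nat n, le_rfl⟩
  · rw [truncation_of_ne_top n hr]
    exact ⟨le_max_left _ _, max_le (inv_le_self_nat n) (min_le_left _ _)⟩

namespace TangentPair

variable {Y : Type*} [MeasurableSpace Y] {A B : ℝ → ℝ} {c : ℝ} {ν : Measure Y} {w q : Y → ℝ≥0∞}

theorem integrable_and_tangentValue_withDensity (h : TangentPair A B c) (hw : Measurable w)
    (hq : Measurable q) (hwtop : ∀ᵐ y ∂ν, w y < ∞) (hqtop : ∀ᵐ y ∂ν, q y < ∞)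
    [IsFiniteMeasure (ν.withDensity w)] [IsFiniteMeasure (ν.withDensity q)]
    (t : TestFunction Y) :
    Integrable (fun y => A (t y) * (w y).toReal + B (t y) * (q y).toReal) ν ∧
      tangentValue A B t (ν.withDensity w) (ν.withDensity q) =
        ∫ y, (A (t y) * (w y).toReal + B (t y) * (q y).toReal) ∂ν := by
  have h1 := (integrable_withDensity_iff_integrable_smul' hw hwtop).1
    (h.integrable_left t (ν.withDensity w))
  have h2 := (integrable_withDensity_iff_integrable_smul' hq hqtop).1
    (h.integrable_right t (ν.withDensity q))
  simp only [smul_eq_mul, mul_comm (w _).toReal, mul_comm (q _).toReal] at h1 h2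
  refine ⟨h1.add h2, ?_⟩
  rw [tangentValue, integral_withDensity_eq_integral_toReal_smul hw hwtop,
    integral_withDensity_eq_integral_toReal_smul hq hqtop]
  simp only [smul_eq_mul, mul_comm (w _).toReal, mul_comm (q _).toReal]
  exact (integral_add h1 h2).symm

/-- A variational divergence is the integral of the pointwise supremum of the tangents. -/
theorem dualDivergence_withDensity (h : TangentPair A B c) (hw : Measurable w)
    (hq : Measurable q) (hwtop : ∀ᵐ y ∂ν, w y < ∞) (hqtop : ∀ᵐ y ∂ν, q y < ∞)
    [IsFiniteMeasure (ν.withDensity w)] [IsFiniteMeasure (ν.withDensity q)] {F : Y → ℝ≥0∞}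
    (hle : ∀ᵐ y ∂ν, ∀ t : ℝ, 0 < t →
      ENNReal.ofReal (A t * (w y).toReal + B t * (q y).toReal) ≤ F y)
    (hlim : ∀ᵐ y ∂ν, Tendsto (fun n : ℕ => ENNReal.ofReal
      (A (truncation n (w y / q y)) * (w y).toReal + B (truncation n (w y / q y)) * (q y).toReal))
      atTop (𝓝 (F y))) :
    dualDivergence A B (ν.withDensity w) (ν.withDensity q) = ∫⁻ y, F y ∂ν := by
  classical
  refine le_antisymm (iSup_le fun t => ?_) ?_
  · obtain ⟨h1, h2⟩ := h.integrable_and_tangentValue_withDensity hw hq hwtop hqtop t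
    rw [h2]
    refine (ofReal_integral_le_lintegral_ofReal h1).trans (lintegral_mono_ae ?_)
    filter_upwards [hle] with y hy using hy _ (t.pos y)
  · let v : ℕ → Y → ℝ := fun n y =>
      A (truncation n (w y / q y)) * (w y).toReal + B (truncation n (w y / q y)) * (q y).toReal
    have hv : ∀ n, Measurable (v n) := fun n =>
      ((h.measurable_left.comp ((measurable_truncation n).comp (hw.div hq))).mul
        hw.ennreal_toReal).add
      ((h.measurable_right.comp ((measurable_truncation n).comp (hw.div hq))).mul
        hq.ennreal_toReal)
    have hset : ∀ n, MeasurableSet {y | 0 ≤ v n y} := fun n => measurableSet_le measurable_const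
      (hv n)
    have hone : ∀ n : ℕ, (1 : ℝ) ∈ Set.Icc ((n : ℝ) + 1)⁻¹ ((n : ℝ) + 1) := fun n =>
      ⟨inv_le_one_of_one_le₀ (by have := n.cast_nonneg (α := ℝ); linarith),
        by have := n.cast_nonneg (α := ℝ); linarith⟩
    -- The optimal tangent point is the density ratio, here truncated. Resetting it to `1` where the
    -- value is negative turns the integrand into its positive part, so that `ENNReal.ofReal`
    -- commutes with the integral and Fatou's lemma applies.
    let t : ℕ → TestFunction Y := fun n =>
      ⟨{y | 0 ≤ v n y}.piecewise (fun y => truncation n (w y / q y)) fun _ => 1,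
        ((measurable_truncation n).comp (hw.div hq)).piecewise (hset n) measurable_const,
        ((n : ℝ) + 1)⁻¹, by positivity, fun y => by
          rw [inv_inv]
          by_cases hy : y ∈ {y | 0 ≤ v n y}
          · rw [Set.piecewise_eq_of_mem _ _ _ hy]
            exact truncation_mem_Icc _ _
          · rw [Set.piecewise_eq_of_notMem _ _ _ hy]
            exact hone n⟩
    have ht : ∀ n y, A (t n y) * (w y).toReal + B (t n y) * (q y).toReal = max (v n y) 0 := by
      intro n y
      by_cases hy : y ∈ {y | 0 ≤ v n y}
      · have : t n y = truncation n (w y / q y) :=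
          Set.piecewise_eq_of_mem _ (fun y => truncation n (w y / q y)) (fun _ => 1) hy
        rw [this, max_eq_left hy]
      · have : t n y = 1 :=
          Set.piecewise_eq_of_notMem _ (fun y => truncation n (w y / q y)) (fun _ => 1) hy
        rw [this, h.left_one, h.right_one, zero_mul, zero_mul, add_zero,
          max_eq_right (not_le.1 hy).le]
    have hval : ∀ n, ∫⁻ y, ENNReal.ofReal (v n y) ∂ν =
        ENNReal.ofReal (tangentValue A B (t n) (ν.withDensity w) (ν.withDensity q)) := by
      intro n
      obtain ⟨h1, h2⟩ := h.integrable_and_tangentValue_withDensity hw hq hwtop hqtop (t n)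
      simp only [ht] at h1 h2
      rw [h2, ofReal_integral_eq_lintegral_ofReal h1 (ae_of_all _ fun y => le_max_right _ _)]
      simp_rw [ENNReal.ofReal_max, ENNReal.ofReal_zero, max_zero]
    calc ∫⁻ y, F y ∂ν = ∫⁻ y, liminf (fun n => ENNReal.ofReal (v n y)) atTop ∂ν :=
          lintegral_congr_ae (by filter_upwards [hlim] with y hy using hy.liminf_eq.symm)
      _ ≤ liminf (fun n => ∫⁻ y, ENNReal.ofReal (v n y) ∂ν) atTop :=
          lintegral_liminf_le fun n => (hv n).ennreal_ofReal
      _ ≤ _ := by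
          simp_rw [hval]
          exact liminf_le_of_le (by isBoundedDefault) fun b hb =>
            (hb.exists.choose_spec).trans (le_dualDivergence A B _ _ _)

end TangentPair

/-! ### Power divergences for orders other than one and infinity -/

/-- The slope of the tangents of the generator of the order `α` divergence. -/
noncomputable def powerLeft (α t : ℝ) : ℝ := α * (t ^ (α - 1) - 1) / (α - 1)

/-- The intercept of the tangents of the generator of the order `α` divergence. -/
noncomputable def powerRight (α t : ℝ) : ℝ := 1 - t ^ α

theorem tangentPair_power {α : ℝ} (h0 : 0 < α) (h1 : α ≠ 1) :
    TangentPair (powerLeft α) (powerRight α) α where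
  measurable_left := by unfold powerLeft; fun_prop
  measurable_right := by unfold powerRight; fun_prop
  monotone := by
    intro s hs t ht hst
    unfold powerLeft
    rcases lt_or_gt_of_ne h1 with h | h
    · have h2 := Real.rpow_le_rpow_of_nonpos (z := α - 1) hs hst (by linarith)
      rw [div_le_div_right_of_neg (by linarith)]
      gcongr
    · have h2 := Real.rpow_le_rpow (z := α - 1) (le_of_lt hs) hst (by linarith)
      have : 0 < α - 1 := by linarith
      gcongr
  antitone := by
    intro s hs t ht hst
    have h2 := Real.rpow_le_rpow (z := α) (le_of_lt hs) hst h0.le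
    unfold powerRight
    linarith
  left_one := by simp [powerLeft]
  right_one := by simp [powerRight]
  pos := h0
  hasDerivAt_left := by
    have h2 : α - 1 ≠ 0 := sub_ne_zero.2 h1
    have h3 := (((Real.hasDerivAt_rpow_const (x := 1) (p := α - 1) (.inl one_ne_zero)).sub_const
      1).const_mul α).div_const (α - 1)
    simp only [Real.one_rpow, mul_one] at h3
    rwa [mul_div_assoc, div_self h2, mul_one] at h3
  hasDerivAt_right := by
    have h3 := (Real.hasDerivAt_rpow_const (x := 1) (p := α) (.inl one_ne_zero)).const_sub 1
    simp only [Real.one_rpow, mul_one] at h3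
    exact h3

theorem tangentPair_log : TangentPair Real.log (fun t => 1 - t) 1 where
  measurable_left := Real.measurable_log
  measurable_right := by fun_prop
  monotone := Real.strictMonoOn_log.monotoneOn
  antitone := fun s _ t _ hst => by dsimp only; linarith
  left_one := Real.log_one
  right_one := sub_self 1
  pos := one_pos
  hasDerivAt_left := by simpa using Real.hasDerivAt_log one_ne_zero
  hasDerivAt_right := (hasDerivAt_id 1).const_sub 1

open scoped Classical in
/-- The integrand of the order `α` power divergence in terms of the two densities. -/
noncomputable def powerIntegrand (α : ℝ) (w q : ℝ≥0∞) : ℝ≥0∞ :=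
  if w ^ α * q ^ (1 - α) = ∞ then ∞ else
    ENNReal.ofReal (((w ^ α * q ^ (1 - α)).toReal - α * w.toReal + (α - 1) * q.toReal) / (α - 1))

theorem toReal_rpow_mul_rpow (α : ℝ) (w q : ℝ≥0∞) :
    (w ^ α * q ^ (1 - α)).toReal = w.toReal ^ α * q.toReal ^ (1 - α) := by
  rw [ENNReal.toReal_mul, ENNReal.toReal_rpow, ENNReal.toReal_rpow]

theorem powerTangent_eq {α : ℝ} (h1 : α ≠ 1) (t w q : ℝ) :
    powerLeft α t * w + powerRight α t * q =
      (α * (t ^ (α - 1) * w) - (α - 1) * (t ^ α * q) - α * w + (α - 1) * q) / (α - 1) := by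
  have : α - 1 ≠ 0 := sub_ne_zero.2 h1
  unfold powerLeft powerRight
  field_simp
  ring

/-- Weighted AM-GM for `t ^ (α - 1) * w` and `t ^ α * q`, whose powers of `t` cancel in the
geometric mean. It says that tangents lie below the generator when `α < 1`. -/
theorem rpow_mul_rpow_le {α t w q : ℝ} (h0 : 0 < α) (h1 : α < 1) (ht : 0 < t) (hw : 0 ≤ w)
    (hq : 0 ≤ q) :
    w ^ α * q ^ (1 - α) ≤ α * (t ^ (α - 1) * w) + (1 - α) * (t ^ α * q) := by
  have h := Real.geom_mean_le_arith_mean2_weighted h0.le (sub_nonneg.2 h1.le)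
    (p₁ := t ^ (α - 1) * w) (p₂ := t ^ α * q) (by positivity) (by positivity) (by ring)
  refine le_trans (le_of_eq ?_) h
  rw [Real.mul_rpow (by positivity) hw, Real.mul_rpow (by positivity) hq, ← Real.rpow_mul ht.le,
    ← Real.rpow_mul ht.le]
  have : t ^ ((α - 1) * α) * t ^ (α * (1 - α)) = 1 := by
    rw [← Real.rpow_add ht]
    ring_nf
    simp
  linear_combination (-(w ^ α * q ^ (1 - α))) * this

/-- The analogue for `α > 1`: AM-GM with weights `1 / α` and `(α - 1) / α`, applied to `w ^ α * q ^
(1 - α)` and `t ^ α * q`. -/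
theorem le_rpow_mul_rpow {α t w q : ℝ} (h1 : 1 < α) (ht : 0 < t) (hw : 0 ≤ w)
    (hq : 0 < q) :
    α * (t ^ (α - 1) * w) ≤ w ^ α * q ^ (1 - α) + (α - 1) * (t ^ α * q) := by
  have h0 : 0 < α := by linarith
  have hα : 0 < α - 1 := by linarith
  have h := Real.geom_mean_le_arith_mean2_weighted (w₁ := 1 / α) (w₂ := (α - 1) / α)
    (p₁ := w ^ α * q ^ (1 - α)) (p₂ := t ^ α * q) (by positivity) (by positivity) (by positivity)
    (by positivity) (by field_simp; ring)
  rw [Real.mul_rpow (by positivity) (by positivity), Real.mul_rpow (by positivity) hq.le,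
    ← Real.rpow_mul hw, ← Real.rpow_mul hq.le, ← Real.rpow_mul ht.le] at h
  have e1 : α * (1 / α) = 1 := by field_simp
  have e2 : α * ((α - 1) / α) = α - 1 := by field_simp
  have e3 : q ^ ((1 - α) * (1 / α)) * q ^ ((α - 1) / α) = 1 := by
    rw [← Real.rpow_add hq]
    have : (1 - α) * (1 / α) + (α - 1) / α = 0 := by field_simp; ring
    rw [this, Real.rpow_zero]
  rw [e1, e2, Real.rpow_one] at h
  have e4 : w * q ^ ((1 - α) * (1 / α)) * (t ^ (α - 1) * q ^ ((α - 1) / α)) = t ^ (α - 1) * w := by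
    linear_combination (t ^ (α - 1) * w) * e3
  rw [e4] at h
  have := mul_le_mul_of_nonneg_left h h0.le
  refine this.trans (le_of_eq ?_)
  field_simp

theorem powerTangent_le {α : ℝ} (h0 : 0 < α) (h1 : α ≠ 1) {w q : ℝ≥0∞} (hw : w ≠ ∞) (hq : q ≠ ∞)
    {t : ℝ} (ht : 0 < t) :
    ENNReal.ofReal (powerLeft α t * w.toReal + powerRight α t * q.toReal) ≤
      powerIntegrand α w q := by
  unfold powerIntegrand
  split_ifs with h
  · exact le_top
  refine ENNReal.ofReal_le_ofReal ?_
  rw [powerTangent_eq h1, toReal_rpow_mul_rpow]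
  rcases lt_or_gt_of_ne h1 with h2 | h2
  · rw [div_le_div_right_of_neg (by linarith)]
    have := rpow_mul_rpow_le h0 h2 ht (ENNReal.toReal_nonneg (a := w))
      (ENNReal.toReal_nonneg (a := q))
    linarith
  · have h3 : 0 < α - 1 := by linarith
    refine div_le_div_of_nonneg_right ?_ h3.le
    rcases eq_or_ne q 0 with rfl | hq0
    · have hw0 : w = 0 := by
        by_contra hw0
        refine h ?_
        rw [ENNReal.zero_rpow_of_neg (by linarith), ENNReal.mul_top]
        simp [hw0, h0.le]
      subst hw0
      simp [Real.zero_rpow h0.ne']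
    · have := le_rpow_mul_rpow h2 ht (ENNReal.toReal_nonneg (a := w)) (ENNReal.toReal_pos hq0 hq)
      linarith

theorem tendsto_natCast_add_one : Tendsto (fun n : ℕ => (n : ℝ) + 1) atTop atTop :=
  tendsto_atTop_add_const_right _ _ tendsto_natCast_atTop_atTop

/-- If both densities are positive, the truncated ratio is eventually exact and the tangent touches
the generator. If one vanishes, the truncation runs to `0` or `∞`; for `q = 0 < w` the limit is
finite when `α < 1` and infinite when `α > 1`. -/
theorem tendsto_powerTangent {α : ℝ} (h0 : 0 < α) (h1 : α ≠ 1) {w q : ℝ≥0∞} (hw : w ≠ ∞)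
    (hq : q ≠ ∞) :
    Tendsto (fun n : ℕ => ENNReal.ofReal (powerLeft α (truncation n (w / q)) * w.toReal +
      powerRight α (truncation n (w / q)) * q.toReal)) atTop (𝓝 (powerIntegrand α w q)) := by
  have hα : α - 1 ≠ 0 := sub_ne_zero.2 h1
  rcases eq_or_ne w 0 with rfl | hw0
  · have h2 : powerIntegrand α 0 q = ENNReal.ofReal q.toReal := by
      simp [powerIntegrand, h0, hα]
    rw [h2, ENNReal.zero_div]
    refine ENNReal.tendsto_ofReal ?_
    have h3 : Tendsto (fun n : ℕ => ((n : ℝ) + 1)⁻¹ ^ α) atTop (𝓝 (0 ^ α)) :=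
      (Real.continuousAt_rpow_const _ _ (.inr h0.le)).tendsto.comp
        (tendsto_inv_atTop_zero.comp tendsto_natCast_add_one)
    rw [Real.zero_rpow h0.ne'] at h3
    have h4 := (h3.const_sub 1).mul_const q.toReal
    simpa [truncation_zero, powerRight] using h4
  rcases eq_or_ne q 0 with rfl | hq0
  · rw [ENNReal.div_zero hw0]
    simp only [truncation_top, ENNReal.toReal_zero, mul_zero, add_zero]
    have hwpos : 0 < w.toReal := ENNReal.toReal_pos hw0 hw
    rcases lt_or_gt_of_ne h1 with h2 | h2
    · have h3 : powerIntegrand α w 0 = ENNReal.ofReal (α * (0 - 1) / (α - 1) * w.toReal) := by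
        rw [powerIntegrand, ENNReal.zero_rpow_of_pos (by linarith)]
        simp
        congr 1
        ring
      rw [h3]
      refine ENNReal.tendsto_ofReal ?_
      have h4 : Tendsto (fun n : ℕ => ((n : ℝ) + 1) ^ (α - 1)) atTop (𝓝 0) := by
        have := (tendsto_rpow_neg_atTop (y := 1 - α) (by linarith)).comp tendsto_natCast_add_one
        simpa [Function.comp_def] using this
      exact (((h4.sub_const 1).const_mul α).div_const (α - 1)).mul_const _
    · have h3 : powerIntegrand α w 0 = ∞ := by
        rw [powerIntegrand, ENNReal.zero_rpow_of_neg (by linarith), ENNReal.mul_top, if_pos rfl]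
        simp [hw0, h0.le]
      rw [h3]
      refine ENNReal.tendsto_ofReal_atTop.comp ?_
      have h4 : Tendsto (fun n : ℕ => ((n : ℝ) + 1) ^ (α - 1)) atTop atTop :=
        (tendsto_rpow_atTop (by linarith)).comp tendsto_natCast_add_one
      refine Tendsto.atTop_mul_const hwpos (Tendsto.atTop_div_const (by linarith) ?_)
      exact Tendsto.const_mul_atTop h0 (tendsto_atTop_add_const_right _ (-1) h4)
  · have hr0 : w / q ≠ 0 := ENNReal.div_ne_zero.2 ⟨hw0, hq⟩
    have hrtop : w / q ≠ ∞ := ENNReal.div_ne_top hw hq0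
    have hwpos : 0 < w.toReal := ENNReal.toReal_pos hw0 hw
    have hqpos : 0 < q.toReal := ENNReal.toReal_pos hq0 hq
    refine tendsto_nhds_of_eventually_eq ?_
    filter_upwards [eventually_truncation_eq hr0 hrtop] with n hn
    have h2 : w ^ α * q ^ (1 - α) ≠ ∞ :=
      ENNReal.mul_ne_top (ENNReal.rpow_ne_top_of_ne_zero hw0 hw)
        (ENNReal.rpow_ne_top_of_ne_zero hq0 hq)
    rw [hn, powerIntegrand, if_neg h2, powerTangent_eq h1, toReal_rpow_mul_rpow,
      ENNReal.toReal_div]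
    have e1 : (w.toReal / q.toReal) ^ (α - 1) * w.toReal =
        w.toReal ^ α * q.toReal ^ (1 - α) := by
      rw [Real.div_rpow hwpos.le hqpos.le, div_mul_eq_mul_div, ← Real.rpow_add_one hwpos.ne',
        div_eq_mul_inv, ← Real.rpow_neg hqpos.le]
      ring_nf
    have e2 : (w.toReal / q.toReal) ^ α * q.toReal =
        w.toReal ^ α * q.toReal ^ (1 - α) := by
      rw [Real.div_rpow hwpos.le hqpos.le, div_mul_eq_mul_div, mul_div_assoc]
      congr 1
      rw [div_eq_iff (by positivity), ← Real.rpow_add hqpos]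
      simp
    rw [e1, e2]
    congr 2
    ring

variable {Y : Type*} [MeasurableSpace Y]

/-- The variational form of the order `α` power divergence. -/
noncomputable def powerDivergence (α : ℝ) (W Q : Measure Y) : ℝ≥0∞ :=
  dualDivergence (powerLeft α) (powerRight α) W Q

theorem powerDivergence_withDensity {α : ℝ} (h0 : 0 < α) (h1 : α ≠ 1) {ν : Measure Y}
    {w q : Y → ℝ≥0∞} (hw : Measurable w) (hq : Measurable q)
    [IsProbabilityMeasure (ν.withDensity w)] [IsProbabilityMeasure (ν.withDensity q)] :
    powerDivergence α (ν.withDensity w) (ν.withDensity q) =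
      ∫⁻ y, powerIntegrand α (w y) (q y) ∂ν := by
  have hfin : ∀ f : Y → ℝ≥0∞, Measurable f → IsProbabilityMeasure (ν.withDensity f) →
      ∀ᵐ y ∂ν, f y < ∞ := fun f hf hprob => by
    refine ae_lt_top hf ?_
    have : (ν.withDensity f) Set.univ = 1 := hprob.measure_univ
    rw [withDensity_apply _ .univ, Measure.restrict_univ] at this
    simp [this]
  have hw' := hfin w hw inferInstance
  have hq' := hfin q hq inferInstance
  refine (tangentPair_power h0 h1).dualDivergence_withDensity hw hq hw' hq' ?_ ?_
  · filter_upwards [hw', hq'] with y h2 h3 t ht using powerTangent_le h0 h1 h2.ne h3.ne ht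
  · filter_upwards [hw', hq'] with y h2 h3 using tendsto_powerTangent h0 h1 h2.ne h3.ne

theorem lintegral_of_withDensity {ν : Measure Y} (f : Y → ℝ≥0∞)
    [IsProbabilityMeasure (ν.withDensity f)] : ∫⁻ y, f y ∂ν = 1 := by
  have : (ν.withDensity f) Set.univ = 1 := measure_univ
  rwa [withDensity_apply _ .univ, Measure.restrict_univ] at this

/-- Written with sums on both sides so that no truncated subtraction in `ℝ≥0∞` occurs when it is
integrated. -/
theorem powerIntegrand_of_lt_one {α : ℝ} (h0 : 0 < α) (h1 : α < 1) {w q : ℝ≥0∞} (hw : w ≠ ∞)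
    (hq : q ≠ ∞) :
    ENNReal.ofReal (1 - α) * powerIntegrand α w q + w ^ α * q ^ (1 - α) =
      ENNReal.ofReal α * w + ENNReal.ofReal (1 - α) * q := by
  have h2 : w ^ α * q ^ (1 - α) ≠ ∞ :=
    ENNReal.mul_ne_top (ENNReal.rpow_ne_top_of_nonneg h0.le hw)
      (ENNReal.rpow_ne_top_of_nonneg (by linarith) hq)
  have h3 := rpow_mul_rpow_le h0 h1 one_pos (ENNReal.toReal_nonneg (a := w))
      (ENNReal.toReal_nonneg (a := q))
  rw [← toReal_rpow_mul_rpow, Real.one_rpow, Real.one_rpow, one_mul, one_mul] at h3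
  rw [powerIntegrand, if_neg h2, ← ENNReal.ofReal_mul (by linarith)]
  set h := w ^ α * q ^ (1 - α)
  rw [← ENNReal.ofReal_toReal h2]
  conv_rhs => rw [← ENNReal.ofReal_toReal hw, ← ENNReal.ofReal_toReal hq]
  have h4 : 0 ≤ w.toReal := ENNReal.toReal_nonneg
  have h5 : 0 ≤ q.toReal := ENNReal.toReal_nonneg
  have h6 : (1 - α) * ((h.toReal - α * w.toReal + (α - 1) * q.toReal) / (α - 1)) =
      α * w.toReal + (1 - α) * q.toReal - h.toReal := by
    have : α - 1 ≠ 0 := by linarith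
    field_simp
    ring
  have h7 : 0 ≤ (1 - α) * q.toReal := mul_nonneg (by linarith) h5
  rw [ENNReal.toReal_ofReal ENNReal.toReal_nonneg, h6,
    ← ENNReal.ofReal_add (by linarith) ENNReal.toReal_nonneg, ← ENNReal.ofReal_mul h0.le,
    ← ENNReal.ofReal_mul (by linarith), ← ENNReal.ofReal_add (by positivity) h7]
  congr 1
  ring

theorem powerIntegrand_of_one_lt {α : ℝ} (h1 : 1 < α) {w q : ℝ≥0∞} (hw : w ≠ ∞)
    (hq : q ≠ ∞) :
    ENNReal.ofReal (α - 1) * powerIntegrand α w q + ENNReal.ofReal α * w =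
      w ^ α * q ^ (1 - α) + ENNReal.ofReal (α - 1) * q := by
  have h0 : 0 < α := by linarith
  have hα : 0 < α - 1 := by linarith
  rw [powerIntegrand]
  split_ifs with h2
  · rw [h2, ENNReal.mul_top (by simpa using hα)]
    simp
  have h3 : α * w.toReal ≤ (w ^ α * q ^ (1 - α)).toReal + (α - 1) * q.toReal := by
    rcases eq_or_ne q 0 with rfl | hq0
    · have hw0 : w = 0 := by
        by_contra hw0
        refine h2 ?_
        rw [ENNReal.zero_rpow_of_neg (by linarith), ENNReal.mul_top]
        simp [hw0, h0.le]
      subst hw0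
      simp [h0]
    · have := le_rpow_mul_rpow h1 one_pos (ENNReal.toReal_nonneg (a := w))
        (ENNReal.toReal_pos hq0 hq)
      rwa [← toReal_rpow_mul_rpow, Real.one_rpow, Real.one_rpow, one_mul, one_mul] at this
  rw [← ENNReal.ofReal_mul hα.le]
  set h := w ^ α * q ^ (1 - α)
  have h4 : 0 ≤ w.toReal := ENNReal.toReal_nonneg
  have h5 : 0 ≤ q.toReal := ENNReal.toReal_nonneg
  have h6 : 0 ≤ h.toReal := ENNReal.toReal_nonneg
  have h7 : (α - 1) * ((h.toReal - α * w.toReal + (α - 1) * q.toReal) / (α - 1)) =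
      h.toReal - α * w.toReal + (α - 1) * q.toReal := by
    field_simp
  have e1 : ENNReal.ofReal α * w = ENNReal.ofReal (α * w.toReal) := by
    rw [ENNReal.ofReal_mul h0.le, ENNReal.ofReal_toReal hw]
  have e2 : h + ENNReal.ofReal (α - 1) * q = ENNReal.ofReal (h.toReal + (α - 1) * q.toReal) := by
    rw [ENNReal.ofReal_add h6 (by positivity), ENNReal.ofReal_mul hα.le, ENNReal.ofReal_toReal hq,
      ENNReal.ofReal_toReal h2]
  rw [e1, e2, h7, ← ENNReal.ofReal_add (by linarith) (by positivity)]
  congr 1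
  ring

section

variable {Y : Type*} [MeasurableSpace Y]

theorem powerDivergence_add_lintegral {α : ℝ} (h0 : 0 < α) (h1 : α < 1) {ν : Measure Y}
    {w q : Y → ℝ≥0∞} (hw : Measurable w) (hq : Measurable q) {W Q : Measure Y}
    [IsProbabilityMeasure W] [IsProbabilityMeasure Q] (hW : W = ν.withDensity w)
    (hQ : Q = ν.withDensity q) :
    ENNReal.ofReal (1 - α) * powerDivergence α W Q + ∫⁻ y, w y ^ α * q y ^ (1 - α) ∂ν = 1 := by
  subst hW hQ
  have hw1 := lintegral_of_withDensity (ν := ν) w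
  have hq1 := lintegral_of_withDensity (ν := ν) q
  have hwtop : ∀ᵐ y ∂ν, w y < ∞ := ae_lt_top hw (by simp [hw1])
  have hqtop : ∀ᵐ y ∂ν, q y < ∞ := ae_lt_top hq (by simp [hq1])
  rw [powerDivergence_withDensity h0 h1.ne hw hq, ← lintegral_const_mul' _ _ ENNReal.ofReal_ne_top,
    ← lintegral_add_right _ (by fun_prop)]
  have : ∀ᵐ y ∂ν, ENNReal.ofReal (1 - α) * powerIntegrand α (w y) (q y) +
      w y ^ α * q y ^ (1 - α) = ENNReal.ofReal α * w y + ENNReal.ofReal (1 - α) * q y := by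
    filter_upwards [hwtop, hqtop] with y h2 h3 using powerIntegrand_of_lt_one h0 h1 h2.ne h3.ne
  rw [lintegral_congr_ae this, lintegral_add_right _ (by fun_prop), lintegral_const_mul _ hw,
    lintegral_const_mul _ hq, hw1, hq1, mul_one, mul_one,
    ← ENNReal.ofReal_add h0.le (by linarith)]
  simp

theorem powerDivergence_add_one {α : ℝ} (h1 : 1 < α) {ν : Measure Y}
    {w q : Y → ℝ≥0∞} (hw : Measurable w) (hq : Measurable q) {W Q : Measure Y}
    [IsProbabilityMeasure W] [IsProbabilityMeasure Q] (hW : W = ν.withDensity w)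
    (hQ : Q = ν.withDensity q) :
    ENNReal.ofReal (α - 1) * powerDivergence α W Q + 1 = ∫⁻ y, w y ^ α * q y ^ (1 - α) ∂ν := by
  subst hW hQ
  have hw1 := lintegral_of_withDensity (ν := ν) w
  have hq1 := lintegral_of_withDensity (ν := ν) q
  have hwtop : ∀ᵐ y ∂ν, w y < ∞ := ae_lt_top hw (by simp [hw1])
  have hqtop : ∀ᵐ y ∂ν, q y < ∞ := ae_lt_top hq (by simp [hq1])
  have h2 : ∫⁻ y, (ENNReal.ofReal (α - 1) * powerIntegrand α (w y) (q y) +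
      ENNReal.ofReal α * w y) ∂ν =
      ∫⁻ y, (w y ^ α * q y ^ (1 - α) + ENNReal.ofReal (α - 1) * q y) ∂ν := by
    refine lintegral_congr_ae ?_
    filter_upwards [hwtop, hqtop] with y h2 h3 using powerIntegrand_of_one_lt h1 h2.ne h3.ne
  have h3 : ENNReal.ofReal α = 1 + ENNReal.ofReal (α - 1) := by
    rw [← ENNReal.ofReal_one, ← ENNReal.ofReal_add zero_le_one (by linarith)]
    congr 1
    ring
  rw [lintegral_add_right _ (by fun_prop), lintegral_add_right _ (by fun_prop),
    lintegral_const_mul' _ _ ENNReal.ofReal_ne_top, lintegral_const_mul _ hw,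
    lintegral_const_mul _ hq, hw1, hq1, mul_one, mul_one, h3, ← add_assoc] at h2
  rw [powerDivergence_withDensity (by linarith) h1.ne' hw hq]
  exact (ENNReal.add_left_inj ENNReal.ofReal_ne_top).1 h2

/-- The integral appearing in the Rényi divergence of order `α`. -/
noncomputable def powerIntegral (α : ℝ) (W Q : Measure Y) : ℝ≥0∞ :=
  ∫⁻ y, W.rnDeriv (W + Q) y ^ α * Q.rnDeriv (W + Q) y ^ (1 - α) ∂(W + Q)

theorem withDensity_rnDeriv_add_left (W Q : Measure Y) [IsFiniteMeasure W] [IsFiniteMeasure Q] :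
    W = (W + Q).withDensity (W.rnDeriv (W + Q)) :=
  (Measure.withDensity_rnDeriv_eq _ _
    (Measure.absolutelyContinuous_of_le (Measure.le_add_right le_rfl))).symm

theorem withDensity_rnDeriv_add_right (W Q : Measure Y) [IsFiniteMeasure W] [IsFiniteMeasure Q] :
    Q = (W + Q).withDensity (Q.rnDeriv (W + Q)) :=
  (Measure.withDensity_rnDeriv_eq _ _
    (Measure.absolutelyContinuous_of_le (Measure.le_add_left le_rfl))).symm

theorem powerIntegral_of_lt_one {α : ℝ} (h0 : 0 < α) (h1 : α < 1) (W Q : Measure Y)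
    [IsProbabilityMeasure W] [IsProbabilityMeasure Q] :
    ENNReal.ofReal (1 - α) * powerDivergence α W Q + powerIntegral α W Q = 1 :=
  powerDivergence_add_lintegral h0 h1 (Measure.measurable_rnDeriv _ _)
    (Measure.measurable_rnDeriv _ _) (withDensity_rnDeriv_add_left W Q)
    (withDensity_rnDeriv_add_right W Q)

theorem powerIntegral_of_one_lt {α : ℝ} (h1 : 1 < α) (W Q : Measure Y)
    [IsProbabilityMeasure W] [IsProbabilityMeasure Q] :
    ENNReal.ofReal (α - 1) * powerDivergence α W Q + 1 = powerIntegral α W Q :=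
  powerDivergence_add_one h1 (Measure.measurable_rnDeriv _ _)
    (Measure.measurable_rnDeriv _ _) (withDensity_rnDeriv_add_left W Q)
    (withDensity_rnDeriv_add_right W Q)

/-- The integral does not depend on the reference measure because it is determined by the
variational divergence, which mentions none. -/
theorem powerIntegral_eq {α : ℝ} (h0 : 0 < α) (h1 : α ≠ 1) {ν : Measure Y}
    {w q : Y → ℝ≥0∞} (hw : Measurable w) (hq : Measurable q) {W Q : Measure Y}
    [IsProbabilityMeasure W] [IsProbabilityMeasure Q] (hW : W = ν.withDensity w)
    (hQ : Q = ν.withDensity q) :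
    powerIntegral α W Q = ∫⁻ y, w y ^ α * q y ^ (1 - α) ∂ν := by
  rcases lt_or_gt_of_ne h1 with h2 | h2
  · have h3 := powerIntegral_of_lt_one h0 h2 W Q
    have h4 := powerDivergence_add_lintegral h0 h2 hw hq hW hQ
    refine (ENNReal.add_right_inj (ne_top_of_le_ne_top ENNReal.one_ne_top
      (le_self_add.trans_eq h3))).1 (h3.trans h4.symm)
  · rw [← powerIntegral_of_one_lt h2, powerDivergence_add_one h2 hw hq hW hQ]

theorem powerIntegral_self {α : ℝ} (h0 : 0 < α) (h1 : α ≠ 1) (W : Measure Y)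
    [IsProbabilityMeasure W] : powerIntegral α W W = 1 := by
  rw [powerIntegral_eq h0 h1 (ν := W) (w := fun _ => 1) (q := fun _ => 1) measurable_const
    measurable_const (by simp) (by simp)]
  simp

end

/-! ### Centers of finite priors for power divergences -/

section

variable {X Y : Type*} [MeasurableSpace X] [MeasurableSpace Y] [MeasurableSingletonClass X]

theorem FinitePrior.exists_lintegral_eq_sum (P : FinitePrior X) :
    ∃ s : Finset X, ∀ f : X → ℝ≥0∞, ∫⁻ x, f x ∂P.toMeasure =
      ∑ x ∈ s, f x * P.toMeasure {x} := by
  obtain ⟨s, hs⟩ := P.2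
  refine ⟨s, fun f => ?_⟩
  have hP : P.toMeasure.restrict s = P.toMeasure := Measure.restrict_eq_self_of_ae_mem (by
    rw [ae_iff]; exact hs)
  conv_lhs => rw [← hP]
  exact lintegral_finset s f

/-- Sibson's identity: `Q` enters every integral through the same factor, so the densities can be
averaged first. The law `q` has density proportional to `(∑ p w ^ α) ^ (1 / α)`, and `K` is the
normalising constant `m` to the power `α`. -/
theorem exists_power_center {α : ℝ} (h0 : 0 < α) (h1 : α ≠ 1) (κ : Kernel X Y)
    [IsMarkovKernel κ] (P : FinitePrior X) :
    ∃ (q : ProbabilityMeasure Y) (K : ℝ≥0∞), ∀ Q : ProbabilityMeasure Y,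
      ∫⁻ x, powerIntegral α (κ x) Q ∂P.toMeasure = K * powerIntegral α (q : Measure Y) Q := by
  obtain ⟨s, hs⟩ := P.exists_lintegral_eq_sum
  have hsum : ∑ x ∈ s, P.toMeasure {x} = 1 := by simpa using (hs fun _ => 1).symm
  set p : X → ℝ≥0∞ := fun x => P.toMeasure {x}
  set ν₀ : Measure Y := ∑ x ∈ s, κ x
  have hle : ∀ x ∈ s, κ x ≤ ν₀ := fun x hx => by
    refine Measure.le_iff.2 fun S _ => ?_
    rw [Measure.finsetSum_apply]
    exact Finset.single_le_sum (f := fun x => κ x S) (fun _ _ => zero_le) hx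
  set w : X → Y → ℝ≥0∞ := fun x => (κ x).rnDeriv ν₀
  have hw : ∀ x, Measurable (w x) := fun x => Measure.measurable_rnDeriv _ _
  have hκ : ∀ x ∈ s, ν₀.withDensity (w x) = κ x := fun x hx =>
    Measure.withDensity_rnDeriv_eq _ _ (Measure.absolutelyContinuous_of_le (hle x hx))
  set S : Y → ℝ≥0∞ := fun y => ∑ x ∈ s, w x y ^ α * p x
  have hS : Measurable S := Finset.measurable_sum _ fun x _ => ((hw x).pow_const α).mul_const _
  set g : Y → ℝ≥0∞ := fun y => S y ^ (α⁻¹)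
  have hg : Measurable g := hS.pow_const _
  set m := ∫⁻ y, g y ∂ν₀
  -- Relative to the sum of the output laws all densities are at most `1`, so `g ≤ 1` on a finite
  -- measure.
  have hmtop : m ≠ ∞ := by
    have h2 : ∀ᵐ y ∂ν₀, g y ≤ 1 := by
      have h3 : ∀ᵐ y ∂ν₀, ∀ x ∈ s, w x y ≤ 1 :=
        (ae_ball_iff s.countable_toSet).2 fun x hx => Measure.rnDeriv_le_one_of_le (hle x hx)
      filter_upwards [h3] with y hy
      refine ENNReal.rpow_le_one ?_ (by positivity)
      refine (Finset.sum_le_sum fun x hx => ?_).trans_eq hsum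
      exact mul_le_of_le_one_left zero_le (ENNReal.rpow_le_one (hy x hx) h0.le)
    refine ne_top_of_le_ne_top ?_ (lintegral_mono_ae h2)
    simp
  have hm0 : m ≠ 0 := by
    intro hm
    obtain ⟨x, hx, hpx⟩ : ∃ x ∈ s, p x ≠ 0 := by
      by_contra! hcon
      rw [Finset.sum_eq_zero hcon] at hsum
      exact zero_ne_one hsum
    have h2 : w x =ᵐ[ν₀] 0 := by
      filter_upwards [(lintegral_eq_zero_iff hg).1 hm] with y hy
      have h3 : S y = 0 := by
        have h4 : S y ^ α⁻¹ = 0 := hy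
        simpa [h0, h0.le, h0.not_gt] using h4
      have h4 := (Finset.sum_eq_zero_iff.1 h3) x hx
      simpa [hpx, h0, h0.le, h0.not_gt] using h4
    have h3 := hκ x hx
    rw [withDensity_congr_ae h2, withDensity_zero] at h3
    exact IsProbabilityMeasure.ne_zero (κ x) h3.symm
  have hq : IsProbabilityMeasure (ν₀.withDensity fun y => m⁻¹ * g y) := ⟨by
    rw [withDensity_apply _ .univ, Measure.restrict_univ, lintegral_const_mul _ hg,
      ENNReal.inv_mul_cancel hm0 hmtop]⟩
  suffices ∀ Q : ProbabilityMeasure Y, ∑ x ∈ s, powerIntegral α (κ x) Q * p x =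
      m ^ α * powerIntegral α (ν₀.withDensity fun y => m⁻¹ * g y) Q from
    ⟨⟨_, hq⟩, m ^ α, fun Q => (hs _).trans (this Q)⟩
  intro Q
  -- `Q` need not be absolutely continuous with respect to `ν₀`, so all laws are rewritten with
  -- densities relative to `ν`.
  set ν := ν₀ + (Q : Measure Y)
  set r := ν₀.rnDeriv ν
  have hr : Measurable r := Measure.measurable_rnDeriv _ _
  have hν₀ : ν₀ = ν.withDensity r := withDensity_rnDeriv_add_left _ _
  set z := (Q : Measure Y).rnDeriv ν
  have hz : Measurable z := Measure.measurable_rnDeriv _ _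
  have hQ : (Q : Measure Y) = ν.withDensity z := withDensity_rnDeriv_add_right _ _
  have hmul : ∀ f : Y → ℝ≥0∞, Measurable f → ν₀.withDensity f = ν.withDensity (r * f) := by
    intro f hf
    rw [withDensity_mul _ hr hf, ← hν₀]
  have e1 : ∀ x ∈ s, powerIntegral α (κ x) Q * p x =
      ∫⁻ y, (w x y ^ α * p x) * (r y ^ α * z y ^ (1 - α)) ∂ν := by
    intro x hx
    rw [powerIntegral_eq h0 h1 (hr.mul (hw x)) hz ((hκ x hx).symm.trans (hmul _ (hw x))) hQ,
      ← lintegral_mul_const _ (by fun_prop)]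
    refine lintegral_congr fun y => ?_
    rw [Pi.mul_apply, ENNReal.mul_rpow_of_nonneg _ _ h0.le]
    ring
  rw [Finset.sum_congr rfl e1, ← lintegral_finsetSum _ fun x _ => by
    have := hw x
    fun_prop]
  have hmg : Measurable fun y => m⁻¹ * g y := hg.const_mul _
  rw [powerIntegral_eq h0 h1 (hr.mul hmg) hz (hmul _ hmg) hQ, ← lintegral_const_mul _ (by fun_prop)]
  refine lintegral_congr fun y => ?_
  rw [Pi.mul_apply, ENNReal.mul_rpow_of_nonneg _ _ h0.le, ENNReal.mul_rpow_of_nonneg _ _ h0.le,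
    ← Finset.sum_mul, ENNReal.inv_rpow, ← ENNReal.rpow_mul, inv_mul_cancel₀ h0.ne',
    ENNReal.rpow_one]
  have hm1 : m ^ α * (m ^ α)⁻¹ = 1 := ENNReal.mul_inv_cancel (by simp [hm0, hmtop])
    (ENNReal.rpow_ne_top_of_nonneg h0.le hmtop)
  calc S y * (r y ^ α * z y ^ (1 - α)) =
      (m ^ α * (m ^ α)⁻¹) * (S y * (r y ^ α * z y ^ (1 - α))) := by rw [hm1, one_mul]
    _ = _ := by ring

end

/-! ### From variational centers to the minimax equalities -/

theorem exists_coe_eq_of_nonneg {a : EReal} (h0 : 0 ≤ a) (ha : a ≠ ⊤) :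
    ∃ r : ℝ, 0 ≤ r ∧ (r : EReal) = a := by
  lift a to ℝ using ⟨ha, (EReal.bot_lt_zero.trans_le h0).ne'⟩
  exact ⟨a, EReal.coe_nonneg.1 h0, rfl⟩

section

variable {X Y : Type*} [MeasurableSpace X] [MeasurableSpace Y]

/-- The minimax theorem follows once there is a unique output law within distance `capacity` of
all the output laws of the kernel. -/
theorem minimax_of_center (κ : Kernel X Y) [IsMarkovKernel κ] (α : ℝ≥0∞)
    (hsup : ∀ Q : ProbabilityMeasure Y,
      (⨆ P : ProbabilityMeasure X, jointDivergence α P κ Q) =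
        ⨆ x, divergence α (κ x) (Q : Measure Y))
    (hcenter : capacity α κ < ⊤ → ∃ q : ProbabilityMeasure Y,
      (∀ x, divergence α (κ x) (q : Measure Y) ≤ capacity α κ) ∧
      ∀ q' : ProbabilityMeasure Y,
        (∀ x, divergence α (κ x) (q' : Measure Y) ≤ capacity α κ) → q' = q) :
    capacity α κ =
        (⨆ P : ProbabilityMeasure X, ⨅ Q : ProbabilityMeasure Y, jointDivergence α P κ Q) ∧
    capacity α κ =
        (⨅ Q : ProbabilityMeasure Y, ⨆ P : ProbabilityMeasure X, jointDivergence α P κ Q) ∧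
    capacity α κ =
        (⨅ Q : ProbabilityMeasure Y, ⨆ W ∈ outputs κ,
          divergence α (W : Measure Y) (Q : Measure Y)) ∧
    (capacity α κ < ⊤ →
      ∃ q : ProbabilityMeasure Y,
        capacity α κ = (⨆ P : ProbabilityMeasure X, jointDivergence α P κ q) ∧
        capacity α κ =
          (⨆ W ∈ outputs κ, divergence α (W : Measure Y) (q : Measure Y)) ∧
        (∀ q' : ProbabilityMeasure Y,
          capacity α κ = (⨆ P : ProbabilityMeasure X, jointDivergence α P κ q') →
            q' = q) ∧
        (∀ q' : ProbabilityMeasure Y, IsCenter α (outputs κ) q' ↔ q' = q)) := by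
  have hout : ∀ Q : ProbabilityMeasure Y,
      (⨆ W ∈ outputs κ, divergence α (W : Measure Y) (Q : Measure Y)) =
        ⨆ x, divergence α (κ x) (Q : Measure Y) := fun Q => iSup_range
  have hle : ∀ Q : ProbabilityMeasure Y,
      capacity α κ ≤ ⨆ x, divergence α (κ x) (Q : Measure Y) := fun Q => by
    rw [← hsup]
    exact iSup_mono fun P => iInf_le (fun Q => jointDivergence α P κ Q) Q
  have hinf : capacity α κ = ⨅ Q : ProbabilityMeasure Y,
      ⨆ x, divergence α (κ x) (Q : Measure Y) := by
    refine le_antisymm (le_iInf hle) ?_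
    rcases eq_or_ne (capacity α κ) ⊤ with h | h
    · rw [h]
      exact le_top
    · obtain ⟨q, hq, -⟩ := hcenter h.lt_top
      exact (iInf_le _ q).trans (iSup_le hq)
  have hrad : radius α (outputs κ) = capacity α κ := by
    rw [hinf]
    exact iInf_congr hout
  refine ⟨rfl, by simp_rw [hsup]; exact hinf, by simp_rw [hout]; exact hinf, fun hlt => ?_⟩
  obtain ⟨q, hq, huniq⟩ := hcenter hlt
  have hval : capacity α κ = ⨆ x, divergence α (κ x) (q : Measure Y) :=
    le_antisymm (hle q) (iSup_le hq)
  have huniq' : ∀ q' : ProbabilityMeasure Y,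
      capacity α κ = ⨆ x, divergence α (κ x) (q' : Measure Y) → q' = q := fun q' h =>
    huniq q' fun x => h ▸ le_iSup (fun x => divergence α (κ x) (q' : Measure Y)) x
  refine ⟨q, by rw [hsup]; exact hval, by rw [hout]; exact hval,
    fun q' h => huniq' q' (by rwa [hsup] at h), fun q' => ?_⟩
  rw [IsCenter, hrad, relativeRadius, hout]
  exact ⟨fun h => huniq' q' h.symm, fun h => h ▸ hval.symm⟩

/-- The Rényi divergence of order `α` is an increasing function of a variational divergence. -/
def IsDualOf (α : ℝ≥0∞) (A B θ : ℝ → ℝ) (Y : Type*) [MeasurableSpace Y] : Prop :=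
  ∀ (W Q : Measure Y) [IsProbabilityMeasure W] [IsProbabilityMeasure Q],
    0 ≤ divergence α W Q ∧ ∀ r : ℝ, 0 ≤ r →
      (divergence α W Q ≤ (r : EReal) ↔ dualDivergence A B W Q ≤ ENNReal.ofReal (θ r))

variable [MeasurableSingletonClass X] {α : ℝ≥0∞} {A B θ β : ℝ → ℝ} {c : ℝ}

/-- Sublevel sets of the Rényi divergence are those of the variational one, which is averaged by a
prior; point masses recover each single `x`. -/
theorem TangentPair.iSup_jointDivergence [Nonempty X] (h : TangentPair A B c)
    (hY : IsDualOf α A B θ Y) (hXY : IsDualOf α A B θ (X × Y)) (κ : Kernel X Y)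
    [IsMarkovKernel κ] (Q : ProbabilityMeasure Y) :
    (⨆ P : ProbabilityMeasure X, jointDivergence α P κ Q) =
        ⨆ x, divergence α (κ x) (Q : Measure Y) := by
  refine le_antisymm (iSup_le fun P => ?_) (iSup_le fun x => ?_)
  · set S := ⨆ x, divergence α (κ x) (Q : Measure Y) with hS
    have hle : ∀ x, divergence α (κ x) (Q : Measure Y) ≤ S := fun x =>
      le_iSup (fun x => divergence α (κ x) (Q : Measure Y)) x
    rcases eq_or_ne S ⊤ with hS | hS
    · rw [hS]
      exact le_top
    have hS0 : 0 ≤ S := (hY (κ (Classical.arbitrary X)) Q).1.trans (hle _)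
    obtain ⟨r, hr, hrS⟩ := exists_coe_eq_of_nonneg hS0 hS
    rw [← hrS] at hle ⊢
    refine ((hXY _ _).2 r hr).2 ?_
    refine (h.dualDivergence_compProd_le (P : Measure X) κ (Q : Measure Y)).trans ?_
    refine (lintegral_mono fun x => ((hY (κ x) Q).2 r hr).1 (hle x)).trans ?_
    simp
  · set D := ⨆ P : ProbabilityMeasure X, jointDivergence α P κ Q
    have hle : jointDivergence α (FinitePrior.dirac x).1 κ Q ≤ D :=
      le_iSup (fun P : ProbabilityMeasure X => jointDivergence α P κ Q) (FinitePrior.dirac x).1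
    rcases eq_or_ne D ⊤ with hD | hD
    · rw [hD]
      exact le_top
    have hD0 : 0 ≤ D := (hXY _ _).1.trans hle
    obtain ⟨r, hr, hrD⟩ := exists_coe_eq_of_nonneg hD0 hD
    rw [← hrD] at hle ⊢
    refine ((hY _ _).2 r hr).2 ?_
    have h1 := ((hXY _ _).2 r hr).1 hle
    obtain ⟨s, hs⟩ := (FinitePrior.dirac x).2
    rw [h.dualDivergence_compProd _ κ _ s hs] at h1
    have h2 := FinitePrior.lintegral_dirac x fun x => dualDivergence A B (κ x) (Q : Measure Y)
    exact h2.symm.le.trans h1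

/-- The Pythagorean constant `β r` may depend on the level `r`: finite capacity bounds the average
at every center by `θ C`, so the single constant `β C` serves all priors. -/
theorem TangentPair.exists_center_of_capacity_lt_top [Nonempty X] (h : TangentPair A B c)
    (hY : IsDualOf α A B θ Y) (hXY : IsDualOf α A B θ (X × Y)) (hθ : Continuous θ) (hθ0 : θ 0 = 0)
    (hβ : ∀ r, 0 ≤ r → 0 < β r) (κ : Kernel X Y) [IsMarkovKernel κ]
    (hcenter : ∀ P : FinitePrior X, ∃ q : ProbabilityMeasure Y,
      (∀ Q : ProbabilityMeasure Y, ∫⁻ x, dualDivergence A B (κ x) q ∂P.toMeasure ≤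
        ∫⁻ x, dualDivergence A B (κ x) Q ∂P.toMeasure) ∧
      ∀ r : ℝ, 0 ≤ r → ∫⁻ x, dualDivergence A B (κ x) q ∂P.toMeasure ≤ ENNReal.ofReal (θ r) →
        ∀ Q : ProbabilityMeasure Y, ∫⁻ x, dualDivergence A B (κ x) q ∂P.toMeasure +
          ENNReal.ofReal (β r) * dualDivergence A B (q : Measure Y) Q ≤
            ∫⁻ x, dualDivergence A B (κ x) Q ∂P.toMeasure)
    (hcap : capacity α κ < ⊤) :
    ∃ q : ProbabilityMeasure Y, (∀ x, divergence α (κ x) (q : Measure Y) ≤ capacity α κ) ∧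
      ∀ q' : ProbabilityMeasure Y,
        (∀ x, divergence α (κ x) (q' : Measure Y) ≤ capacity α κ) → q' = q := by
  choose q hmin hq using hcenter
  have hjoint : ∀ (P : FinitePrior X) (Q : ProbabilityMeasure Y),
      dualDivergence A B ((P.1 : Measure X).compProd κ) ((P.1 : Measure X).prod Q) =
        ∫⁻ x, dualDivergence A B (κ x) Q ∂P.toMeasure := fun P Q => by
    obtain ⟨s, hs⟩ := P.2
    exact h.dualDivergence_compProd _ κ _ s hs
  -- Minimising the averaged variational divergence also minimises the joint Rényi divergence, so
  -- its value at the center is at most the information.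
  have hinfo : ∀ P : FinitePrior X, jointDivergence α P.1 κ (q P) ≤ capacity α κ := by
    intro P
    refine le_trans (le_iInf fun Q => ?_) (le_iSup (fun P => information α P κ) P.1)
    rcases eq_or_ne (jointDivergence α P.1 κ Q) ⊤ with hD | hD
    · rw [hD]
      exact le_top
    have hD0 : 0 ≤ jointDivergence α P.1 κ Q := (hXY _ _).1
    obtain ⟨D, hr, hDr⟩ := exists_coe_eq_of_nonneg hD0 hD
    rw [← hDr]
    refine ((hXY _ _).2 D hr).2 ?_
    rw [hjoint]
    refine (hmin P Q).trans ?_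
    rw [← hjoint]
    exact ((hXY _ _).2 D hr).1 hDr.ge
  have hcap0 : 0 ≤ capacity α κ :=
    ((hXY _ _).1).trans (hinfo (FinitePrior.dirac (Classical.arbitrary X)))
  obtain ⟨C, hC0, hC⟩ := exists_coe_eq_of_nonneg hcap0 hcap.ne
  rw [← hC] at hinfo ⊢
  have hV : ∀ P : FinitePrior X,
      ∫⁻ x, dualDivergence A B (κ x) (q P) ∂P.toMeasure ≤ ENNReal.ofReal (θ C) := fun P => by
    rw [← hjoint]
    exact ((hXY _ _).2 C hC0).1 (hinfo P)
  set M := ⨆ P : FinitePrior X, ∫⁻ x, dualDivergence A B (κ x) (q P) ∂P.toMeasure with hM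
  have hMle : M ≤ ENNReal.ofReal (θ C) := iSup_le hV
  obtain ⟨q₀, hq₀, huniq⟩ := h.exists_unique_center κ (fun P Q => hq P C hC0 (hV P) Q) hM.symm
    (ne_top_of_le_ne_top ENNReal.ofReal_ne_top hMle)
    (by simpa using hβ C hC0) ENNReal.ofReal_ne_top
  -- If finite priors fell short of `θ C`, continuity would give `r < C` with `M < θ r`, and `q₀`
  -- would bound the capacity by `r`. Equality is needed to apply uniqueness at level `C`.
  have hMeq : M = ENNReal.ofReal (θ C) := by
    refine hMle.antisymm (not_lt.1 fun hlt => ?_)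
    have hCpos : 0 < C := by
      refine hC0.lt_of_ne fun hC' => ?_
      rw [← hC', hθ0] at hlt
      simp at hlt
    have h1 : ∀ᶠ r in 𝓝[<] C, M < ENNReal.ofReal (θ r) :=
      ((ENNReal.continuous_ofReal.comp hθ).tendsto C).mono_left nhdsWithin_le_nhds
        |>.eventually (lt_mem_nhds hlt)
    have h2 : ∀ᶠ r in 𝓝[<] C, r ∈ Set.Ico 0 C := Ico_mem_nhdsLT hCpos
    obtain ⟨r, hr, hr0, hrC⟩ := (h1.and h2).exists
    have h3 : capacity α κ ≤ (r : EReal) := by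
      refine iSup_le fun P => (iInf_le _ q₀).trans ?_
      refine (le_iSup (fun P => jointDivergence α P κ q₀) P).trans ?_
      rw [h.iSup_jointDivergence hY hXY]
      exact iSup_le fun x => ((hY _ _).2 r hr0).2 ((hq₀ x).trans hr.le)
    rw [← hC, EReal.coe_le_coe_iff] at h3
    linarith
  refine ⟨q₀, fun x => ((hY _ _).2 C hC0).2 ((hq₀ x).trans hMle), fun q' hq' => huniq q' fun x => ?_⟩
  rw [hMeq]
  exact ((hY _ _).2 C hC0).1 (hq' x)

end

/-! ### Orders other than one and infinity -/

theorem inv_mul_le_coe_iff_of_pos {k r : ℝ} (hk : 0 < k) (x : EReal) :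
    ((k⁻¹ : ℝ) : EReal) * x ≤ (r : EReal) ↔ x ≤ ((k * r : ℝ) : EReal) := by
  have hk' : 0 < k⁻¹ := by positivity
  induction x with
  | bot => simp [EReal.coe_mul_bot_of_pos hk']
  | coe x =>
    rw [← EReal.coe_mul, EReal.coe_le_coe_iff, EReal.coe_le_coe_iff, inv_mul_le_iff₀ hk]
  | top =>
    rw [EReal.coe_mul_top_of_pos hk']
    simp [-EReal.coe_mul]

theorem inv_mul_le_coe_iff_of_neg {k r : ℝ} (hk : k < 0) (x : EReal) :
    ((k⁻¹ : ℝ) : EReal) * x ≤ (r : EReal) ↔ ((k * r : ℝ) : EReal) ≤ x := by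
  have hk' : k⁻¹ < 0 := inv_lt_zero.2 hk
  induction x with
  | bot =>
    rw [EReal.coe_mul_bot_of_neg hk']
    simp [-EReal.coe_mul]
  | coe x =>
    rw [← EReal.coe_mul, EReal.coe_le_coe_iff, EReal.coe_le_coe_iff, inv_mul_eq_div,
      div_le_iff_of_neg hk, mul_comm]
  | top => simp [EReal.coe_mul_top_of_neg hk']

theorem log_le_coe_iff (x : ℝ≥0∞) (s : ℝ) :
    ENNReal.log x ≤ (s : EReal) ↔ x ≤ ENNReal.ofReal (Real.exp s) := by
  rw [← EReal.exp_le_exp_iff, ENNReal.exp_log, EReal.exp_coe]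

theorem coe_le_log_iff (x : ℝ≥0∞) (s : ℝ) :
    (s : EReal) ≤ ENNReal.log x ↔ ENNReal.ofReal (Real.exp s) ≤ x := by
  rw [← EReal.exp_le_exp_iff, ENNReal.exp_log, EReal.exp_coe]

/-- The Rényi divergence of order `α` is at most `r` iff the power divergence is at most
`powerScale α r`. -/
noncomputable def powerScale (α r : ℝ) : ℝ := (Real.exp ((α - 1) * r) - 1) / (α - 1)

theorem continuous_powerScale (α : ℝ) : Continuous (powerScale α) := by
  unfold powerScale
  fun_prop

theorem powerScale_zero (α : ℝ) : powerScale α 0 = 0 := by simp [powerScale]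

variable {X Y : Type*} [MeasurableSpace X] [MeasurableSpace Y]

theorem isDualOf_power {α : ℝ≥0∞} (h0 : α ≠ 0) (h1 : α ≠ 1) (htop : α ≠ ∞) :
    IsDualOf α (powerLeft α.toReal) (powerRight α.toReal) (powerScale α.toReal) Y := by
  intro W Q _ _
  have hD : divergence α W Q =
      (((α.toReal - 1)⁻¹ : ℝ) : EReal) * ENNReal.log (powerIntegral α.toReal W Q) := by
    simp only [divergence, h0, h1, htop, if_false, powerIntegral]
  have ha0 : 0 < α.toReal := ENNReal.toReal_pos h0 htop
  have ha1 : α.toReal ≠ 1 := fun h => h1 (by rw [← ENNReal.ofReal_toReal htop, h]; simp)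
  rw [hD]
  change _ ∧ ∀ r : ℝ, 0 ≤ r → (_ ↔ powerDivergence α.toReal W Q ≤ _)
  set a := α.toReal
  set J := powerDivergence a W Q
  set H := powerIntegral a W Q
  rcases lt_or_gt_of_ne ha1 with ha | ha
  · have hJH : ENNReal.ofReal (1 - a) * J + H = 1 := powerIntegral_of_lt_one ha0 ha W Q
    have ha' : ENNReal.ofReal (1 - a) ≠ 0 := by simpa using ha
    have hHtop : H ≠ ∞ := fun h => by simp [h] at hJH
    have hJtop : J ≠ ∞ := fun h => by simp [h, ENNReal.mul_top ha'] at hJH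
    have hreal : (1 - a) * J.toReal + H.toReal = 1 := by
      have := congrArg ENNReal.toReal hJH
      rwa [ENNReal.toReal_add (ENNReal.mul_ne_top ENNReal.ofReal_ne_top hJtop) hHtop,
        ENNReal.toReal_mul, ENNReal.toReal_ofReal (by linarith), ENNReal.toReal_one] at this
    have hH1 : H ≤ 1 := hJH ▸ le_add_self
    refine ⟨?_, fun r hr => ?_⟩
    · have hk : ((a - 1)⁻¹ : ℝ) ≤ 0 := inv_nonpos.2 (by linarith)
      have h2 : ENNReal.log H ≤ 0 := ENNReal.log_le_zero_iff.2 hH1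
      exact EReal.mul_nonneg_iff.2 (.inr ⟨EReal.coe_nonpos.2 hk, h2⟩)
    · rw [inv_mul_le_coe_iff_of_neg (by linarith), coe_le_log_iff]
      rw [← ENNReal.ofReal_toReal hHtop, ← ENNReal.ofReal_toReal hJtop,
        ENNReal.ofReal_le_ofReal_iff ENNReal.toReal_nonneg, powerScale]
      have hexp : Real.exp ((a - 1) * r) ≤ 1 :=
        Real.exp_le_one_iff.2 (mul_nonpos_of_nonpos_of_nonneg (by linarith) hr)
      rw [ENNReal.ofReal_le_ofReal_iff (div_nonneg_of_nonpos (by linarith) (by linarith)),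
        le_div_iff_of_neg (by linarith)]
      constructor <;> intro h <;> linarith
  · have hJH : ENNReal.ofReal (a - 1) * J + 1 = H := powerIntegral_of_one_lt ha W Q
    have hk : 0 < a - 1 := by linarith
    refine ⟨?_, fun r hr => ?_⟩
    · have h2 : 0 ≤ ENNReal.log H := ENNReal.zero_le_log_iff.2 (hJH ▸ le_add_self)
      have h3 : (0 : EReal) ≤ (((a - 1)⁻¹ : ℝ) : EReal) := EReal.coe_nonneg.2 (by positivity)
      exact EReal.mul_nonneg h3 h2
    · rw [inv_mul_le_coe_iff_of_pos hk, log_le_coe_iff, ← hJH]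
      have hexp : 1 ≤ Real.exp ((a - 1) * r) := Real.one_le_exp (by positivity)
      rcases eq_or_ne J ∞ with hJ | hJ
      · rw [hJ, ENNReal.mul_top (by simpa using ha)]
        simp
      · rw [← ENNReal.ofReal_toReal hJ, ← ENNReal.ofReal_mul hk.le, ← ENNReal.ofReal_one,
          ← ENNReal.ofReal_add (by positivity) zero_le_one,
          ENNReal.ofReal_le_ofReal_iff (by positivity), powerScale,
          ENNReal.ofReal_le_ofReal_iff (div_nonneg (by linarith) hk.le), le_div_iff₀ hk]
        constructor <;> intro h <;> linarith

theorem FinitePrior.lintegral_const_mul_add [MeasurableSingletonClass X] (P : FinitePrior X)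
    (c : ℝ≥0∞) (f g : X → ℝ≥0∞) :
    ∫⁻ x, (c * f x + g x) ∂P.toMeasure =
      c * ∫⁻ x, f x ∂P.toMeasure + ∫⁻ x, g x ∂P.toMeasure := by
  obtain ⟨s, hs⟩ := P.exists_lintegral_eq_sum
  simp only [hs, add_mul, Finset.sum_add_distrib, Finset.mul_sum, mul_assoc]

/-- Sibson's identity becomes a Pythagorean identity once power integrals are affine in power
divergences; `Q = q` identifies `K`. -/
theorem exists_powerDivergence_center [MeasurableSingletonClass X] {α : ℝ} (h0 : 0 < α)
    (h1 : α ≠ 1) (κ : Kernel X Y) [IsMarkovKernel κ] (P : FinitePrior X) :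
    ∃ (q : ProbabilityMeasure Y) (K : ℝ≥0∞),
      (∀ Q : ProbabilityMeasure Y, ∫⁻ x, powerDivergence α (κ x) Q ∂P.toMeasure =
        ∫⁻ x, powerDivergence α (κ x) q ∂P.toMeasure +
          K * powerDivergence α (q : Measure Y) Q) ∧
      (α < 1 → ENNReal.ofReal (1 - α) * ∫⁻ x, powerDivergence α (κ x) q ∂P.toMeasure + K = 1) ∧
      (1 < α → 1 ≤ K) := by
  obtain ⟨q, K, hq⟩ := exists_power_center h0 h1 κ P
  have hqq := hq q
  rw [powerIntegral_self h0 h1, mul_one] at hqq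
  refine ⟨q, K, ?_⟩
  rcases lt_or_gt_of_ne h1 with h2 | h2
  · have hV : ∀ Q : ProbabilityMeasure Y,
        ENNReal.ofReal (1 - α) * ∫⁻ x, powerDivergence α (κ x) Q ∂P.toMeasure +
          ∫⁻ x, powerIntegral α (κ x) Q ∂P.toMeasure = 1 := fun Q => by
      rw [← P.lintegral_const_mul_add]
      simp_rw [powerIntegral_of_lt_one h0 h2]
      simp
    have hK : ENNReal.ofReal (1 - α) * ∫⁻ x, powerDivergence α (κ x) q ∂P.toMeasure + K = 1 := by
      rw [← hqq]
      exact hV q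
    refine ⟨fun Q => ?_, fun _ => hK, fun h => absurd h h2.not_gt⟩
    have hQ := hV Q
    have hJ := powerIntegral_of_lt_one h0 h2 (q : Measure Y) (Q : Measure Y)
    rw [hq] at hQ
    set d := ENNReal.ofReal (1 - α)
    have hd0 : d ≠ 0 := by simpa [d] using h2
    set H := powerIntegral α (q : Measure Y) (Q : Measure Y)
    set J := powerDivergence α (q : Measure Y) (Q : Measure Y)
    have hKH : K * H ≠ ∞ := ne_top_of_le_ne_top ENNReal.one_ne_top (hQ ▸ le_add_self)
    have h3 : d * ∫⁻ x, powerDivergence α (κ x) Q ∂P.toMeasure + K * H =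
        d * (∫⁻ x, powerDivergence α (κ x) q ∂P.toMeasure + K * J) + K * H := by
      calc _ = 1 := hQ
        _ = d * ∫⁻ x, powerDivergence α (κ x) q ∂P.toMeasure + K * 1 := by rw [mul_one, hK]
        _ = _ := by rw [← hJ]; ring
    exact (ENNReal.mul_right_inj hd0 ENNReal.ofReal_ne_top).1 ((ENNReal.add_left_inj hKH).1 h3)
  · have hV : ∀ Q : ProbabilityMeasure Y,
        ENNReal.ofReal (α - 1) * ∫⁻ x, powerDivergence α (κ x) Q ∂P.toMeasure + 1 =
          ∫⁻ x, powerIntegral α (κ x) Q ∂P.toMeasure := fun Q => by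
      simp_rw [← powerIntegral_of_one_lt h2]
      rw [P.lintegral_const_mul_add]
      simp
    have hK : ENNReal.ofReal (α - 1) * ∫⁻ x, powerDivergence α (κ x) q ∂P.toMeasure + 1 = K := by
      rw [← hqq]
      exact hV q
    refine ⟨fun Q => ?_, fun h => absurd h h2.not_gt, fun _ => hK ▸ le_add_self⟩
    have hQ := hV Q
    have hJ := powerIntegral_of_one_lt h2 (q : Measure Y) (Q : Measure Y)
    rw [hq] at hQ
    set d := ENNReal.ofReal (α - 1)
    have hd0 : d ≠ 0 := by simpa [d] using h2
    set H := powerIntegral α (q : Measure Y) (Q : Measure Y)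
    set J := powerDivergence α (q : Measure Y) (Q : Measure Y)
    have h3 : d * ∫⁻ x, powerDivergence α (κ x) Q ∂P.toMeasure + 1 =
        d * (∫⁻ x, powerDivergence α (κ x) q ∂P.toMeasure + K * J) + 1 := by
      calc _ = K * H := hQ
        _ = K * (d * J) + K := by rw [← hJ]; ring
        _ = K * (d * J) + (d * ∫⁻ x, powerDivergence α (κ x) q ∂P.toMeasure + 1) := by rw [hK]
        _ = _ := by ring
    exact (ENNReal.mul_right_inj hd0 ENNReal.ofReal_ne_top).1
      ((ENNReal.add_left_inj ENNReal.one_ne_top).1 h3)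

theorem exists_center_power [MeasurableSingletonClass X] [Nonempty X] {α : ℝ≥0∞} (h0 : α ≠ 0)
    (h1 : α ≠ 1) (htop : α ≠ ∞) (κ : Kernel X Y) [IsMarkovKernel κ] (hcap : capacity α κ < ⊤) :
    ∃ q : ProbabilityMeasure Y, (∀ x, divergence α (κ x) (q : Measure Y) ≤ capacity α κ) ∧
      ∀ q' : ProbabilityMeasure Y,
        (∀ x, divergence α (κ x) (q' : Measure Y) ≤ capacity α κ) → q' = q := by
  have ha0 : 0 < α.toReal := ENNReal.toReal_pos h0 htop
  have ha1 : α.toReal ≠ 1 := fun h => h1 (by rw [← ENNReal.ofReal_toReal htop, h]; simp)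
  refine (tangentPair_power ha0 ha1).exists_center_of_capacity_lt_top (isDualOf_power h0 h1 htop)
    (isDualOf_power h0 h1 htop) (continuous_powerScale _) (powerScale_zero _)
    -- For `α > 1` the constant `K` is at least `1`. For `α < 1` it is `1 - (1 - α) * V`, with `V`
    -- the average at the center, and `V ≤ powerScale α r` makes it at least the exponential.
    (β := fun r => min 1 (Real.exp ((α.toReal - 1) * r)))
    (fun r _ => lt_min one_pos (Real.exp_pos _)) κ (fun P => ?_) hcap
  obtain ⟨q, K, hq, hlt, hgt⟩ := exists_powerDivergence_center ha0 ha1 κ P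
  refine ⟨q, fun Q => (le_self_add).trans (hq Q).ge, fun r hr hV Q => ?_⟩
  refine le_trans ?_ (hq Q).ge
  change _ + _ * powerDivergence α.toReal (q : Measure Y) Q ≤ _
  refine add_le_add le_rfl (mul_le_mul_left ?_ _)
  rcases lt_or_gt_of_ne ha1 with ha | ha
  · have hVr : ENNReal.ofReal (1 - α.toReal) *
        ∫⁻ x, powerDivergence α.toReal (κ x) q ∂P.toMeasure ≤
          ENNReal.ofReal (1 - Real.exp ((α.toReal - 1) * r)) := by
      refine (mul_le_mul_right hV _).trans_eq ?_
      rw [← ENNReal.ofReal_mul (by linarith), powerScale]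
      congr 1
      have : α.toReal - 1 ≠ 0 := by linarith
      field_simp
      ring
    have hexp : Real.exp ((α.toReal - 1) * r) ≤ 1 :=
      Real.exp_le_one_iff.2 (mul_nonpos_of_nonpos_of_nonneg (by linarith) hr)
    have h3 : ENNReal.ofReal (1 - Real.exp ((α.toReal - 1) * r)) +
        ENNReal.ofReal (Real.exp ((α.toReal - 1) * r)) ≤
          ENNReal.ofReal (1 - Real.exp ((α.toReal - 1) * r)) + K := by
      rw [← ENNReal.ofReal_add (by linarith) (Real.exp_pos _).le]
      simp only [sub_add_cancel, ENNReal.ofReal_one]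
      rw [← hlt ha]
      gcongr
    rw [min_eq_right hexp]
    exact (ENNReal.add_le_add_iff_left ENNReal.ofReal_ne_top).1 h3
  · refine le_trans (ENNReal.ofReal_le_ofReal (min_le_left _ _)) ?_
    simpa using hgt ha

/-! ### Order one: Kullback-Leibler divergence -/

section

variable {Y : Type*} [MeasurableSpace Y]

theorem logTangent_le_klFun {t w : ℝ} (ht : 0 < t) (hw : 0 ≤ w) :
    Real.log t * w + (1 - t) ≤ InformationTheory.klFun w := by
  rw [InformationTheory.klFun_apply]
  rcases hw.eq_or_lt with rfl | hw
  · simp [ht.le]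
  · have h := Real.log_le_sub_one_of_pos (div_pos ht hw)
    rw [Real.log_div ht.ne' hw.ne'] at h
    have h2 := mul_le_mul_of_nonneg_right h hw.le
    have h3 : (t / w - 1) * w = t - w := by field_simp
    linarith

theorem klDiv_eq_dualDivergence (W Q : Measure Y) [IsProbabilityMeasure W]
    [IsProbabilityMeasure Q] :
    InformationTheory.klDiv W Q = dualDivergence Real.log (fun t => 1 - t) W Q := by
  by_cases hac : W ≪ Q
  · have hW : Q.withDensity (W.rnDeriv Q) = W := Measure.withDensity_rnDeriv_eq _ _ hac
    have hQ : Q.withDensity (fun _ => 1) = Q := withDensity_one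
    have : IsFiniteMeasure (Q.withDensity (W.rnDeriv Q)) := by rw [hW]; infer_instance
    have : IsFiniteMeasure (Q.withDensity fun _ => 1) := by rw [hQ]; infer_instance
    have key := tangentPair_log.dualDivergence_withDensity (ν := Q) (w := W.rnDeriv Q)
      (q := fun _ => 1) (F := fun y => ENNReal.ofReal (InformationTheory.klFun
        (W.rnDeriv Q y).toReal)) (Measure.measurable_rnDeriv _ _) measurable_const
      (Measure.rnDeriv_lt_top _ _) (by simp) ?_ ?_
    · rw [hW, hQ] at key
      rw [key, InformationTheory.klDiv_eq_lintegral_klFun_of_ac hac]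
    · refine ae_of_all _ fun y t ht => ENNReal.ofReal_le_ofReal ?_
      simpa using logTangent_le_klFun ht ENNReal.toReal_nonneg
    · filter_upwards [Measure.rnDeriv_lt_top W Q] with y hy
      simp only [div_one, ENNReal.toReal_one, mul_one]
      rcases eq_or_ne (W.rnDeriv Q y) 0 with h0 | h0
      · rw [h0]
        simp only [truncation_zero, ENNReal.toReal_zero, mul_zero, zero_add,
          InformationTheory.klFun_zero]
        refine ENNReal.tendsto_ofReal ?_
        simpa using (tendsto_inv_atTop_zero.comp tendsto_natCast_add_one).const_sub (1 : ℝ)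
      · refine tendsto_nhds_of_eventually_eq ?_
        filter_upwards [eventually_truncation_eq h0 hy.ne] with n hn
        rw [hn, InformationTheory.klFun_apply]
        congr 1
        ring
  · rw [InformationTheory.klDiv_of_not_ac hac]
    obtain ⟨S, hS, hQS, hWS⟩ : ∃ S, MeasurableSet S ∧ Q S = 0 ∧ W S ≠ 0 := by
      by_contra! hcon
      exact hac (Measure.AbsolutelyContinuous.mk fun S hS h => hcon S hS h)
    have hpos : 0 < W.real S := ENNReal.toReal_pos hWS (measure_ne_top _ _)
    -- On a set `S` with `Q S = 0 < W S`, the test value `n + 1` costs nothing under `Q` and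
    -- contributes `log (n + 1) * W S`, which is unbounded.
    refine (top_le_iff.1 (le_of_tendsto' (x := atTop)
      (f := fun n : ℕ => ENNReal.ofReal (Real.log ((n : ℝ) + 1) * W.real S)) ?_ fun n => ?_)).symm
    · exact ENNReal.tendsto_ofReal_atTop.comp
        ((Real.tendsto_log_atTop.comp tendsto_natCast_add_one).atTop_mul_const hpos)
    · refine le_trans (le_of_eq ?_) (le_dualDivergence _ _
        (TestFunction.ofSet S hS ((n : ℝ) + 1) (by positivity)) W Q)
      rw [tangentPair_log.tangentValue_ofSet]
      simp [measureReal_def, hQS]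

theorem klDiv_eq_ofReal_integral_llr {W Q : Measure Y} [IsProbabilityMeasure W]
    [IsProbabilityMeasure Q] (hac : W ≪ Q) (hint : Integrable (llr W Q) W) :
    0 ≤ ∫ y, llr W Q y ∂W ∧
      InformationTheory.klDiv W Q = ENNReal.ofReal (∫ y, llr W Q y ∂W) := by
  have h1 := InformationTheory.integral_llr_add_sub_measure_univ_nonneg hac hint
  have h2 := InformationTheory.klDiv_of_ac_of_integrable hac hint
  simp only [probReal_univ, add_sub_cancel_right] at h1 h2
  exact ⟨h1, h2⟩

open scoped Classical in
theorem isDualOf_one : IsDualOf 1 Real.log (fun t => 1 - t) id Y := by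
  intro W Q _ _
  have hD : divergence 1 W Q = if W ≪ Q ∧ Integrable (llr W Q) W then
      ((∫ y, llr W Q y ∂W : ℝ) : EReal) else ⊤ := by
    simp [divergence]
  rw [hD, ← klDiv_eq_dualDivergence]
  split_ifs with h
  · obtain ⟨h1, h2⟩ := klDiv_eq_ofReal_integral_llr h.1 h.2
    refine ⟨EReal.coe_nonneg.2 h1, fun r hr => ?_⟩
    rw [h2, EReal.coe_le_coe_iff, id, ENNReal.ofReal_le_ofReal_iff hr]
  · refine ⟨le_top, fun r hr => ?_⟩
    rw [not_ne_iff.1 (mt InformationTheory.klDiv_ne_top_iff.1 h)]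
    simp

theorem llr_add_llr {W V Q : Measure Y} [IsProbabilityMeasure W] [IsProbabilityMeasure V]
    [IsProbabilityMeasure Q] (hWV : W ≪ V) (hVQ : V ≪ Q) :
    llr W Q =ᵐ[W] fun y => llr W V y + llr V Q y := by
  filter_upwards [(hWV.trans hVQ).ae_le (Measure.rnDeriv_mul_rnDeriv (κ := Q) hWV),
    Measure.rnDeriv_pos hWV, hWV.ae_le (Measure.rnDeriv_lt_top W V),
    hWV.ae_le (Measure.rnDeriv_pos hVQ), (hWV.trans hVQ).ae_le (Measure.rnDeriv_lt_top V Q)]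
    with y h1 h2 h3 h4 h5
  rw [llr, llr, llr, ← h1, Pi.mul_apply, ENNReal.toReal_mul,
    Real.log_mul (ENNReal.toReal_pos h2.ne' h3.ne).ne' (ENNReal.toReal_pos h4.ne' h5.ne).ne']

/-- The bound `log (p t) ≤ p t - 1`, integrated against `W` and combined with `p • W ≤ V`, keeps
every tangent value below `-log p`. It makes each output law finitely divergent from a mixture
containing it. -/
theorem klDiv_ne_top_of_smul_le {W V : Measure Y} [IsProbabilityMeasure W]
    [IsProbabilityMeasure V] {p : ℝ≥0∞} (hp : p ≠ 0) (hle : p • W ≤ V) :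
    InformationTheory.klDiv W V ≠ ∞ := by
  have hptop : p ≠ ∞ := by
    rintro rfl
    have := hle Set.univ
    simp at this
  have hp0 : 0 < p.toReal := ENNReal.toReal_pos hp hptop
  rw [klDiv_eq_dualDivergence]
  refine ne_top_of_le_ne_top (b := ENNReal.ofReal (-Real.log p.toReal)) ENNReal.ofReal_ne_top
    (iSup_le fun t => ENNReal.ofReal_le_ofReal ?_)
  have hti : ∀ W : Measure Y, IsFiniteMeasure W → Integrable (fun y => t y) W := fun W _ => by
    have := (integrable_const (1 : ℝ)).sub (tangentPair_log.integrable_right t W)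
    refine this.congr (ae_of_all _ fun y => ?_)
    simp
  have h1 : p.toReal * ∫ y, t y ∂W ≤ ∫ y, t y ∂V := by
    have := integral_mono_measure hle (ae_of_all _ fun y => (t.pos y).le) (hti V inferInstance)
    rwa [integral_smul_measure, smul_eq_mul] at this
  have htW := (hti W inferInstance).const_mul p.toReal
  have h2 : ∫ y, Real.log (t y) ∂W ≤ ∫ y, (p.toReal * t y - (1 + Real.log p.toReal)) ∂W := by
    refine integral_mono (tangentPair_log.integrable_left t W) (htW.sub (integrable_const _))
      fun y => ?_
    have := Real.log_le_sub_one_of_pos (mul_pos hp0 (t.pos y))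
    rw [Real.log_mul hp0.ne' (t.pos y).ne'] at this
    dsimp only
    linarith
  have h3 : ∫ y, (p.toReal * t y - (1 + Real.log p.toReal)) ∂W =
      p.toReal * ∫ y, t y ∂W - (1 + Real.log p.toReal) := by
    rw [integral_sub htW (integrable_const _), integral_const_mul]
    simp
  have h4 : tangentValue Real.log (fun t => 1 - t) t W V =
      ∫ y, Real.log (t y) ∂W + (1 - ∫ y, t y ∂V) := by
    rw [tangentValue, integral_sub (integrable_const _) (hti V inferInstance)]
    simp
  linarith

end

section

variable {X Y : Type*} [MeasurableSpace X] [MeasurableSpace Y] [MeasurableSingletonClass X]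

/-- The compensation identity: `q` is the mixture of the outputs, and averaging the chain rule for
log-likelihood ratios splits off the divergence from `q` to `Q`. -/
theorem exists_klDiv_center (κ : Kernel X Y) [IsMarkovKernel κ] (P : FinitePrior X) :
    ∃ q : ProbabilityMeasure Y, ∀ Q : ProbabilityMeasure Y,
      ∫⁻ x, InformationTheory.klDiv (κ x) q ∂P.toMeasure +
        InformationTheory.klDiv (q : Measure Y) Q ≤
          ∫⁻ x, InformationTheory.klDiv (κ x) Q ∂P.toMeasure := by
  classical
  obtain ⟨s, hs, hp0⟩ : ∃ s : Finset X, (∀ f : X → ℝ≥0∞, ∫⁻ x, f x ∂P.toMeasure =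
      ∑ x ∈ s, f x * P.toMeasure {x}) ∧ ∀ x ∈ s, P.toMeasure {x} ≠ 0 := by
    obtain ⟨s, hs⟩ := P.exists_lintegral_eq_sum
    -- Points of zero mass are dropped so that a finite weighted sum forces each divergence in it to
    -- be finite.
    refine ⟨s.filter fun x => P.toMeasure {x} ≠ 0, fun f => ?_, fun x hx =>
      (Finset.mem_filter.1 hx).2⟩
    rw [hs, Finset.sum_filter_of_ne fun x _ h => right_ne_zero_of_mul h]
  have hsum : ∑ x ∈ s, P.toMeasure {x} = 1 := by simpa using (hs fun _ => 1).symm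
  set p : X → ℝ≥0∞ := fun x => P.toMeasure {x}
  have hptop : ∀ x, p x ≠ ∞ := fun x => measure_ne_top _ _
  set q : Measure Y := ∑ x ∈ s, p x • κ x
  have hqprob : IsProbabilityMeasure q := ⟨by
    rw [Measure.finsetSum_apply]
    simpa using hsum⟩
  have hle : ∀ x ∈ s, p x • κ x ≤ q := fun x hx => by
    refine Measure.le_iff.2 fun S _ => ?_
    rw [Measure.finsetSum_apply]
    exact Finset.single_le_sum (f := fun x => (p x • κ x) S) (fun _ _ => zero_le) hx
  suffices ∀ Q : ProbabilityMeasure Y, ∑ x ∈ s, InformationTheory.klDiv (κ x) q * p x +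
      InformationTheory.klDiv q Q ≤ ∑ x ∈ s, InformationTheory.klDiv (κ x) Q * p x from
    ⟨⟨q, hqprob⟩, fun Q => by rw [hs, hs]; exact this Q⟩
  intro Q
  rcases eq_or_ne (∑ x ∈ s, InformationTheory.klDiv (κ x) Q * p x) ∞ with htop | htop
  · rw [htop]
    exact le_top
  have hQ : ∀ x ∈ s, κ x ≪ Q ∧ Integrable (llr (κ x) Q) (κ x) := fun x hx => by
    refine InformationTheory.klDiv_ne_top_iff.1 fun h => ?_
    refine ENNReal.sum_ne_top.1 htop x hx ?_
    rw [h, ENNReal.top_mul (hp0 x hx)]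
  have hq : ∀ x ∈ s, κ x ≪ q ∧ Integrable (llr (κ x) q) (κ x) := fun x hx =>
    InformationTheory.klDiv_ne_top_iff.1 (klDiv_ne_top_of_smul_le (hp0 x hx) (hle x hx))
  have hqQ : q ≪ Q := by
    refine Measure.AbsolutelyContinuous.mk fun S _ hS => ?_
    rw [Measure.finsetSum_apply]
    refine Finset.sum_eq_zero fun x hx => ?_
    rw [Measure.smul_apply, (hQ x hx).1 hS, smul_zero]
  have hchain : ∀ x ∈ s, llr (κ x) Q =ᵐ[κ x] fun y => llr (κ x) q y + llr q Q y := fun x hx =>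
    llr_add_llr (hq x hx).1 hqQ
  have hint : ∀ x ∈ s, Integrable (llr q Q) (κ x) := fun x hx => by
    refine ((hQ x hx).2.sub (hq x hx).2).congr ?_
    filter_upwards [hchain x hx] with y hy
    rw [Pi.sub_apply, hy]
    ring
  have hintp : ∀ x ∈ s, Integrable (llr q Q) (p x • κ x) := fun x hx =>
    (hint x hx).smul_measure (hptop x)
  have hqint : Integrable (llr q Q) q := integrable_finsetSum_measure.2 hintp
  obtain ⟨h1, h2⟩ := klDiv_eq_ofReal_integral_llr hqQ hqint
  have hval : ∫ y, llr q Q y ∂q = ∑ x ∈ s, (p x).toReal * ∫ y, llr q Q y ∂κ x := by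
    rw [integral_finsetSum_measure hintp]
    refine Finset.sum_congr rfl fun x _ => ?_
    rw [integral_smul_measure, smul_eq_mul]
  have hreal : ∀ V : Measure Y, IsProbabilityMeasure V →
      (∀ x ∈ s, κ x ≪ V ∧ Integrable (llr (κ x) V) (κ x)) →
      0 ≤ ∑ x ∈ s, (p x).toReal * ∫ y, llr (κ x) V y ∂κ x ∧
      ∑ x ∈ s, InformationTheory.klDiv (κ x) V * p x =
        ENNReal.ofReal (∑ x ∈ s, (p x).toReal * ∫ y, llr (κ x) V y ∂κ x) := by
    intro V _ hV
    have hnn : ∀ x ∈ s, 0 ≤ (p x).toReal * ∫ y, llr (κ x) V y ∂κ x := fun x hx =>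
      mul_nonneg ENNReal.toReal_nonneg (klDiv_eq_ofReal_integral_llr (hV x hx).1 (hV x hx).2).1
    refine ⟨Finset.sum_nonneg hnn, ?_⟩
    rw [ENNReal.ofReal_sum_of_nonneg hnn]
    refine Finset.sum_congr rfl fun x hx => ?_
    rw [(klDiv_eq_ofReal_integral_llr (hV x hx).1 (hV x hx).2).2,
      ENNReal.ofReal_mul ENNReal.toReal_nonneg, ENNReal.ofReal_toReal (hptop x), mul_comm]
  obtain ⟨h3, h4⟩ := hreal q hqprob hq
  rw [(hreal Q inferInstance hQ).2, h4, h2, ← ENNReal.ofReal_add h3 h1, hval,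
    ← Finset.sum_add_distrib]
  refine le_of_eq (congrArg _ (Finset.sum_congr rfl fun x hx => ?_))
  rw [integral_congr_ae (hchain x hx), integral_add (hq x hx).2 (hint x hx), mul_add]

theorem exists_center_one [Nonempty X] (κ : Kernel X Y) [IsMarkovKernel κ]
    (hcap : capacity 1 κ < ⊤) :
    ∃ q : ProbabilityMeasure Y, (∀ x, divergence 1 (κ x) (q : Measure Y) ≤ capacity 1 κ) ∧
      ∀ q' : ProbabilityMeasure Y,
        (∀ x, divergence 1 (κ x) (q' : Measure Y) ≤ capacity 1 κ) → q' = q := by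
  refine tangentPair_log.exists_center_of_capacity_lt_top isDualOf_one isDualOf_one
    continuous_id rfl (β := fun _ => 1) (fun _ _ => one_pos) κ (fun P => ?_) hcap
  obtain ⟨q, hq⟩ := exists_klDiv_center κ P
  simp_rw [klDiv_eq_dualDivergence] at hq
  refine ⟨q, fun Q => le_self_add.trans (hq Q), fun r _ _ Q => ?_⟩
  simpa using hq Q

end

/-! ### Order infinity: domination of measures -/

section

variable {Y : Type*} [MeasurableSpace Y]

/-- Bounding the density ratio almost everywhere is the same as dominating the measure. Finite `d`
makes `d.exp` neither `0` nor `∞`, so division can be cleared even where the density of `Q`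
vanishes. -/
theorem divergence_top_le_iff (W Q : Measure Y) [IsProbabilityMeasure W] [IsProbabilityMeasure Q]
    {d : EReal} (hd : d ≠ ⊤) (hd' : d ≠ ⊥) :
    divergence ∞ W Q ≤ d ↔ W ≤ d.exp • Q := by
  have hc : d.exp ≠ 0 := by simpa using hd'
  have hc' : d.exp ≠ ∞ := by simpa using hd
  have hD : divergence ∞ W Q = ENNReal.log (essSup (fun y => W.rnDeriv (W + Q) y /
      Q.rnDeriv (W + Q) y) (W + Q)) := by
    simp [divergence]
  set ν := W + Q with hν
  have hw : Measurable (W.rnDeriv ν) := Measure.measurable_rnDeriv _ _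
  have hq : Measurable (Q.rnDeriv ν) := Measure.measurable_rnDeriv _ _
  have hW : W = ν.withDensity (W.rnDeriv ν) := withDensity_rnDeriv_add_left W Q
  have hQ : d.exp • Q = ν.withDensity (d.exp • Q.rnDeriv ν) := by
    rw [withDensity_smul _ hq]
    congr 1
    exact withDensity_rnDeriv_add_right W Q
  have h1 : divergence ∞ W Q ≤ d ↔ ∀ᵐ y ∂ν, W.rnDeriv ν y / Q.rnDeriv ν y ≤ d.exp := by
    rw [hD, ← EReal.exp_le_exp_iff, ENNReal.exp_log]
    exact ⟨fun h => (ENNReal.ae_le_essSup _).mono fun y hy => hy.trans h,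
      fun h => essSup_le_of_ae_le _ h⟩
  have h2 : (∀ᵐ y ∂ν, W.rnDeriv ν y / Q.rnDeriv ν y ≤ d.exp) ↔
      W.rnDeriv ν ≤ᵐ[ν] d.exp • Q.rnDeriv ν := by
    refine eventually_congr (ae_of_all _ fun y => ?_)
    rw [ENNReal.div_le_iff_le_mul (.inr hc') (.inr hc)]
    rfl
  rw [h1, h2]
  refine ⟨fun h => ?_, fun h => ?_⟩
  · rw [hQ]
    conv_lhs => rw [hW]
    exact withDensity_mono h
  · refine ae_le_of_forall_setLIntegral_le_of_sigmaFinite hw fun S hS _ => ?_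
    rw [← withDensity_apply _ hS, ← withDensity_apply _ hS, ← hQ, ← hW]
    exact h S

theorem divergence_top_nonneg (W Q : Measure Y) [IsProbabilityMeasure W]
    [IsProbabilityMeasure Q] : 0 ≤ divergence ∞ W Q := by
  by_contra! h
  obtain ⟨r, h1, h2⟩ := EReal.lt_iff_exists_real_btwn.1 h
  have h3 := (divergence_top_le_iff W Q (EReal.coe_ne_top r) (EReal.coe_ne_bot r)).1 h1.le
    Set.univ
  rw [Measure.smul_apply, measure_univ, measure_univ, smul_eq_mul, mul_one,
    EReal.one_le_exp_iff] at h3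
  exact absurd h2 (not_lt.2 h3)

end

section

variable {X Y : Type*} [MeasurableSpace X] [MeasurableSpace Y]

theorem compProd_le_smul_prod (P : Measure X) [IsProbabilityMeasure P] (κ : Kernel X Y)
    [IsMarkovKernel κ] (Q : Measure Y) [IsProbabilityMeasure Q] {c : ℝ≥0∞} (hc : c ≠ ∞)
    (h : ∀ x, κ x ≤ c • Q) : P.compProd κ ≤ c • P.prod Q := by
  refine Measure.le_iff.2 fun S hS => ?_
  rw [Measure.smul_apply, Measure.compProd_apply hS, Measure.prod_apply hS, smul_eq_mul,
    ← lintegral_const_mul' _ _ hc]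
  exact lintegral_mono fun x => h x _

theorem le_smul_of_compProd_le [MeasurableSingletonClass X] (P : Measure X)
    [IsProbabilityMeasure P] (κ : Kernel X Y)
    [IsMarkovKernel κ] (Q : Measure Y) [IsProbabilityMeasure Q] {c : ℝ≥0∞}
    (h : P.compProd κ ≤ c • P.prod Q) {x : X} (hx : P {x} ≠ 0) : κ x ≤ c • Q := by
  refine Measure.le_iff.2 fun S hS => ?_
  have h1 := h ({x} ×ˢ S)
  rw [Measure.compProd_apply_prod (measurableSet_singleton x) hS, Measure.smul_apply,
    Measure.prod_prod, lintegral_singleton, smul_eq_mul] at h1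
  have h2 : κ x S * P {x} ≤ (c * Q S) * P {x} := h1.trans_eq (by ring)
  rw [Measure.smul_apply, smul_eq_mul]
  exact (ENNReal.mul_le_mul_iff_left hx (measure_ne_top _ _)).1 h2

theorem iSup_jointDivergence_top [MeasurableSingletonClass X] [Nonempty X] (κ : Kernel X Y)
    [IsMarkovKernel κ] (Q : ProbabilityMeasure Y) :
    (⨆ P : ProbabilityMeasure X, jointDivergence ∞ P κ Q) =
      ⨆ x, divergence ∞ (κ x) (Q : Measure Y) := by
  refine le_antisymm (iSup_le fun P => ?_) (iSup_le fun x => ?_)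
  · set S := ⨆ x, divergence ∞ (κ x) (Q : Measure Y)
    have hle : ∀ x, divergence ∞ (κ x) (Q : Measure Y) ≤ S := fun x =>
      le_iSup (fun x => divergence ∞ (κ x) (Q : Measure Y)) x
    rcases eq_or_ne S ⊤ with hS | hS
    · rw [hS]
      exact le_top
    have hS' : S ≠ ⊥ := (EReal.bot_lt_zero.trans_le
      ((divergence_top_nonneg _ _).trans (hle (Classical.arbitrary X)))).ne'
    exact (divergence_top_le_iff _ _ hS hS').2 (compProd_le_smul_prod _ κ _ (by simpa using hS)
      fun x => (divergence_top_le_iff _ _ hS hS').1 (hle x))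
  · set D := ⨆ P : ProbabilityMeasure X, jointDivergence ∞ P κ Q
    have hle : jointDivergence ∞ (FinitePrior.dirac x).1 κ Q ≤ D :=
      le_iSup (fun P : ProbabilityMeasure X => jointDivergence ∞ P κ Q) (FinitePrior.dirac x).1
    rcases eq_or_ne D ⊤ with hD | hD
    · rw [hD]
      exact le_top
    have hD' : D ≠ ⊥ := (EReal.bot_lt_zero.trans_le ((divergence_top_nonneg _ _).trans hle)).ne'
    refine (divergence_top_le_iff _ _ hD hD').2 (le_smul_of_compProd_le (Measure.dirac x) κ _
      ((divergence_top_le_iff _ _ hD hD').1 hle) ?_)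
    simp

theorem FinitePrior.exists_forall_ne_zero [MeasurableSingletonClass X] [Nonempty X]
    (s : Finset X) : ∃ P : FinitePrior X, ∀ x ∈ s, P.toMeasure {x} ≠ 0 := by
  induction s using Finset.cons_induction with
  | empty => exact ⟨dirac (Classical.arbitrary X), by simp⟩
  | cons a s ha ih =>
    obtain ⟨P, hP⟩ := ih
    obtain ⟨M, hM⟩ := exists_mix (dirac a) P 2⁻¹ 2⁻¹ (ENNReal.inv_two_add_inv_two)
    refine ⟨M, fun x hx => ?_⟩
    have h1 := hM (Set.indicator {x} 1)
    simp only [lintegral_indicator_one (measurableSet_singleton x)] at h1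
    rw [h1]
    rcases Finset.mem_cons.1 hx with rfl | hx
    · have : (dirac x).toMeasure {x} = 1 := by
        change Measure.dirac x {x} = 1
        simp
      simp [this]
    · simp [hP x hx]

/-- A directed union of finite suprema of measures. -/
theorem exists_measure_eq_iSup_finset_sup {ι : Type*} (m : ι → Measure Y) :
    ∃ μ : Measure Y, ∀ S, MeasurableSet S → μ S = ⨆ s : Finset ι, (s.sup m) S := by
  have hmono : ∀ S, Monotone fun s : Finset ι => (s.sup m) S := fun S s u hsu =>
    Finset.sup_mono (f := m) hsu S
  refine ⟨Measure.ofMeasurable (fun S _ => ⨆ s : Finset ι, (s.sup m) S) (by simp)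
    fun f hf hd => ?_, fun S hS => Measure.ofMeasurable_apply S hS⟩
  simp_rw [measure_iUnion hd hf, ENNReal.tsum_eq_iSup_sum,
    ENNReal.finsetSum_iSup_of_monotone fun i => hmono (f i)]
  exact iSup_comm

/-- The measure `μ` is the least one above all outputs. A law within the capacity of all outputs
dominates `μ` after scaling by `exp` of the capacity, and equal masses then force equality. -/
theorem exists_center_top [MeasurableSingletonClass X] [Nonempty X] (κ : Kernel X Y)
    [IsMarkovKernel κ] (hcap : capacity ∞ κ < ⊤) :
    ∃ q : ProbabilityMeasure Y, (∀ x, divergence ∞ (κ x) (q : Measure Y) ≤ capacity ∞ κ) ∧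
      ∀ q' : ProbabilityMeasure Y,
        (∀ x, divergence ∞ (κ x) (q' : Measure Y) ≤ capacity ∞ κ) → q' = q := by
  obtain ⟨μ, hμ⟩ := exists_measure_eq_iSup_finset_sup fun x => κ x
  have hκμ : ∀ x, κ x ≤ μ := fun x => by
    refine Measure.le_iff.2 fun S hS => ?_
    rw [hμ S hS]
    refine le_trans ?_ (le_iSup (fun s : Finset X => (s.sup fun x => κ x) S) {x})
    simp
  have hμle : ∀ ρ : Measure Y, (∀ x, κ x ≤ ρ) → μ ≤ ρ := fun ρ h => by
    refine Measure.le_iff.2 fun S hS => ?_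
    rw [hμ S hS]
    exact iSup_le fun s => (Finset.sup_le fun x _ => h x : (s.sup fun x => κ x) ≤ ρ) S
  have hmass1 : 1 ≤ μ Set.univ := by
    have := hκμ (Classical.arbitrary X) Set.univ
    rwa [measure_univ] at this
  have hinfo : ∀ P : ProbabilityMeasure X, 0 ≤ information ∞ P κ := fun P =>
    le_iInf fun Q => divergence_top_nonneg _ _
  have hcap0 : 0 ≤ capacity ∞ κ :=
    (hinfo (FinitePrior.dirac (Classical.arbitrary X)).1).trans
      (le_iSup (fun P => information ∞ P κ) _)
  have hbot : capacity ∞ κ ≠ ⊥ := (EReal.bot_lt_zero.trans_le hcap0).ne'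
  -- A prior charging every point of `s` forces any competing `Q`, scaled by `exp` of its joint
  -- divergence, to dominate the supremum over `s`; total masses then bound the information from
  -- below.
  have hmass : μ Set.univ ≤ (capacity ∞ κ).exp := by
    rw [hμ _ .univ]
    refine iSup_le fun s => ?_
    obtain ⟨P, hP⟩ := FinitePrior.exists_forall_ne_zero s
    rw [← ENNReal.exp_log ((s.sup fun x => κ x) Set.univ)]
    refine EReal.exp_monotone ?_
    refine le_trans (le_iInf fun Q => ?_) (le_iSup (fun P => information ∞ P κ) P.1)
    rcases eq_or_ne (jointDivergence ∞ P.1 κ Q) ⊤ with hD | hD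
    · rw [hD]
      exact le_top
    have hD' : jointDivergence ∞ P.1 κ Q ≠ ⊥ :=
      (EReal.bot_lt_zero.trans_le (divergence_top_nonneg _ _)).ne'
    have h1 := (divergence_top_le_iff _ _ hD hD').1 le_rfl
    have h2 : (s.sup fun x => κ x) ≤ (jointDivergence ∞ P.1 κ Q).exp • (Q : Measure Y) :=
      Finset.sup_le fun x hx => le_smul_of_compProd_le _ κ _ h1 (hP x hx)
    have h3 := h2 Set.univ
    rw [Measure.smul_apply, measure_univ (μ := (Q : Measure Y)), smul_eq_mul, mul_one] at h3
    rwa [← EReal.exp_le_exp_iff, ENNReal.exp_log]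
  set c := (capacity ∞ κ).exp
  have hctop : c ≠ ∞ := by simpa [c] using hcap.ne
  set m := μ Set.univ
  have hmtop : m ≠ ∞ := ne_top_of_le_ne_top hctop hmass
  have hm0 : m ≠ 0 := (zero_lt_one.trans_le hmass1).ne'
  have hqprob : IsProbabilityMeasure (m⁻¹ • μ) := ⟨by
    rw [Measure.smul_apply, smul_eq_mul, ENNReal.inv_mul_cancel hm0 hmtop]⟩
  have hmq : m • (m⁻¹ • μ) = μ := by
    rw [smul_smul, ENNReal.mul_inv_cancel hm0 hmtop, one_smul]
  have hq : ∀ x, divergence ∞ (κ x) (m⁻¹ • μ) ≤ ENNReal.log m := fun x => by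
    rw [divergence_top_le_iff _ _ (by simpa using hmtop) (by simpa using hm0), ENNReal.exp_log, hmq]
    exact hκμ x
  -- Conversely, normalised `μ` is within `log m` of every output, so the capacity is at most `log
  -- m`.
  have hmc : m = c := by
    refine hmass.antisymm ?_
    rw [← ENNReal.exp_log m]
    refine EReal.exp_monotone (iSup_le fun P => (iInf_le _ ⟨_, hqprob⟩).trans ?_)
    refine (le_iSup (fun P => jointDivergence ∞ P κ ⟨_, hqprob⟩) P).trans ?_
    exact (iSup_jointDivergence_top κ (⟨_, hqprob⟩ : ProbabilityMeasure Y)).le.trans (iSup_le hq)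
  refine ⟨⟨_, hqprob⟩, fun x => (hq x).trans_eq ?_, fun q' hq' => Subtype.ext ?_⟩
  · rw [hmc, EReal.log_exp]
  · have h1 : μ ≤ c • (q' : Measure Y) := hμle _ fun x =>
      (divergence_top_le_iff _ _ hcap.ne hbot).1 (hq' x)
    have : IsFiniteMeasure (c • (q' : Measure Y)) := Measure.smul_finite _ hctop
    have : IsFiniteMeasure μ := ⟨hmtop.lt_top⟩
    have h2 : μ = c • (q' : Measure Y) := by
      refine Measure.eq_of_le_of_measure_univ_eq h1 ?_
      rw [Measure.smul_apply, measure_univ (μ := (q' : Measure Y)), smul_eq_mul, mul_one]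
      exact hmc
    change (q' : Measure Y) = m⁻¹ • μ
    rw [h2, hmc, smul_smul, ENNReal.inv_mul_cancel (hmc ▸ hm0) hctop, one_smul]

end

end Renyi

theorem mainTheorem11 {X Y : Type*} [MeasurableSpace X] [MeasurableSpace Y]
    [MeasurableSpace.CountablySeparated X] [Nonempty X]
    (κ : Kernel X Y) [IsMarkovKernel κ] (α : ℝ≥0∞) (hα : 0 < α) :
    Renyi.capacity α κ =
        (⨆ P : ProbabilityMeasure X, ⨅ Q : ProbabilityMeasure Y,
          Renyi.jointDivergence α P κ Q) ∧
    Renyi.capacity α κ =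
        (⨅ Q : ProbabilityMeasure Y, ⨆ P : ProbabilityMeasure X,
          Renyi.jointDivergence α P κ Q) ∧
    Renyi.capacity α κ =
        (⨅ Q : ProbabilityMeasure Y, ⨆ W ∈ Renyi.outputs κ,
          Renyi.divergence α (W : Measure Y) (Q : Measure Y)) ∧
    (Renyi.capacity α κ < ⊤ →
      ∃ q : ProbabilityMeasure Y,
        Renyi.capacity α κ = (⨆ P : ProbabilityMeasure X, Renyi.jointDivergence α P κ q) ∧
        Renyi.capacity α κ =
          (⨆ W ∈ Renyi.outputs κ, Renyi.divergence α (W : Measure Y) (q : Measure Y)) ∧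
        (∀ q' : ProbabilityMeasure Y,
          Renyi.capacity α κ = (⨆ P : ProbabilityMeasure X, Renyi.jointDivergence α P κ q') →
            q' = q) ∧
        (∀ q' : ProbabilityMeasure Y, Renyi.IsCenter α (Renyi.outputs κ) q' ↔ q' = q)) := by
  -- Countable separation enters only here: measurable singletons let point masses count as finitely
  -- supported priors and allow gluing over finite sets.
  have := MeasurableSpace.measurableSingletonClass_of_countablySeparated (α := X)
  rcases eq_or_ne α ∞ with rfl | htop
  · exact Renyi.minimax_of_center κ ∞ (Renyi.iSup_jointDivergence_top κ)
      (Renyi.exists_center_top κ)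
  rcases eq_or_ne α 1 with rfl | h1
  · exact Renyi.minimax_of_center κ 1
      (Renyi.tangentPair_log.iSup_jointDivergence Renyi.isDualOf_one Renyi.isDualOf_one κ)
      (Renyi.exists_center_one κ)
  · have ha0 : 0 < α.toReal := ENNReal.toReal_pos hα.ne' htop
    have ha1 : α.toReal ≠ 1 := fun h => h1 (by rw [← ENNReal.ofReal_toReal htop, h]; simp)
    exact Renyi.minimax_of_center κ α
      ((Renyi.tangentPair_power ha0 ha1).iSup_jointDivergence
        (Renyi.isDualOf_power hα.ne' h1 htop) (Renyi.isDualOf_power hα.ne' h1 htop) κ)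
      (Renyi.exists_center_power hα.ne' h1 htop κ)
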